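/- Let $M\ge 2$ be an integer, $P>0$, $\lambda>0$, $\eta>2$, $r_0>0$, $N_0\ge 0$. A user at the origin of $\mathbb R^2$ is served by its nearest base station (BS), at distance $r_0$. The interfering BSs $x_1,x_2,\dots$ form a Poisson point process of intensity $\lambda$ on $\{x\in\mathbb R^2:\|x\|>r_0\}$; put $r_k=\|x_k\|$. The fading coefficients $h_0,h_1,h_2,\dots\sim\mathcal{CN}(0,1)$ (Rayleigh fading), the interfering symbols $s_1,s_2,\dots\sim\mathcal{CN}(0,1)$ (Gaussian signalling) and the noise $n\sim\mathcal{CN}(0,N_0)$ are independent of one another and of the point process. All BSs transmit with power $P$ on the same channel, so that the received signal, when the serving BS sends the symbol $s_0$, is $$y_0=\sqrt P\,s_0h_0r_0^{-\eta/2}+i_{agg}+n,\qquad i_{agg}=\sum_{k\ge1}\sqrt P\,s_kh_kr_k^{-\eta/2}.$$ Let $\mathcal I_{agg}=\sum_{k\ge1}P|h_k|^2r_k^{-\eta}$ be the aggregate interference power and $\Upsilon=P|h_0|^2r_0^{-\eta}/(\mathcal I_{agg}+N_0)$ the SINR. With the $M$-QAM parameters $$w_1=2\,\frac{\sqrt M-1}{\sqrt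 M},\qquad w_2=-\Big(\frac{\sqrt M-1}{\sqrt M}\Big)^2,\qquad \beta_1=\beta_2=\frac{3}{2(M-1)},$$ let the downlink average symbol error probability (ASEP) at distance $r_0$ be $$\bar{\mathcal S}(r_0)=w_1\,\mathbb E\big[\operatorname{erfc}\sqrt{\beta_1\Upsilon}\big]+w_2\,\mathbb E\big[\operatorname{erfc}^2\sqrt{\beta_2\Upsilon}\big].$$ Then the series $\mathcal I_{agg}$ and (in the sense of convergence of partial sums) $i_{agg}$ converge almost surely. If $M=m^2$ is a perfect square, $\bar{\mathcal S}(r_0)$ is the probability that the coherent maximum likelihood (minimum distance) detector, which knows $h_0$, does not recover $s_0$ from $y_0$, where $s_0$ is drawn uniformly, independently of everything else, from the unit-power square $M$-QAM constellation. Moreover $$\bar{\mathcal S}(r_0)=\sum_{c=1}^2 w_c\left(1-\frac{c}{\sqrt\pi}\int_0^\infty\frac{\operatorname{erfc}(\sqrt z\,\mathbb 1_{\{c=2\}})}{\sqrt z}\exp\Big\{-z\Big(1+\frac{N_0r_0^\eta}{P\beta_c}\Big)-\frac{2\pi\lambda z r_0^2}{\beta_c(\eta-2)}\,{}_2F_1\Big(1,1-\tfrac2\eta;2-\tfrac2\eta;-\tfrac{z}{\beta_c}\Big)\Big\}\,\mathrm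 dz\right),$$ and, if $\eta=4$, $$\bar{\mathcal S}(r_0)=\sum_{c=1}^2 w_c\left(1-\frac{c}{\sqrt\pi}\int_0^\infty\frac{\operatorname{erfc}(\sqrt z\,\mathbb 1_{\{c=2\}})}{\sqrt z}\exp\Big\{-z\Big(1+\frac{N_0r_0^4}{P\beta_c}\Big)-\pi\lambda r_0^2\sqrt{\tfrac{z}{\beta_c}}\arctan\sqrt{\tfrac{z}{\beta_c}}\Big\}\,\mathrm dz\right),$$ the integrals for $c=1,2$ in the first formula being absolutely convergent. Here $\operatorname{erfc}(x)=\frac{2}{\sqrt\pi}\int_x^\infty e^{-t^2}\mathrm dt$ and ${}_2F_1$ is the Gauss hypergeometric function, analytically continued from its power series to $(-\infty,1)$. -/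

import Mathlib

open MeasureTheory ProbabilityTheory Filter Topology
open scoped NNReal ENNReal

noncomputable section

/-! ### Special functions -/

/-- The complementary error function `erfc x = (2 / √π) ∫_x^∞ exp (-t²) dt`. -/
def erfc (x : ℝ) : ℝ :=
  2 / √Real.pi * ∫ t in Set.Ioi x, Real.exp (-t ^ 2)

/-- `F` is, on the half-line `(-∞, 1)`, the real-analytic continuation of the Gauss
hypergeometric series `∑ (a)ₙ (b)ₙ / (c)ₙ xⁿ / n!` (which converges only for `|x| < 1`). -/
def IsGaussContinuation (a b c : ℝ) (F : ℝ → ℝ) : Prop :=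
  AnalyticOnNhd ℝ F (Set.Iio 1) ∧
    ∀ x ∈ Set.Ioo (-1 : ℝ) 1, F x = ordinaryHypergeometric a b c x

open Classical in
/-- The Gauss hypergeometric function `₂F₁(a, b; c; x)` for real parameters and real `x < 1`
(principal branch): the analytic continuation of the Gauss series to `(-∞, 1)`. -/
def gauss2F1 (a b c x : ℝ) : ℝ :=
  if h : ∃ F : ℝ → ℝ, IsGaussContinuation a b c F then h.choose x else 0

/-- The continuation is unique, so `gauss2F1` does not depend on the choice made. -/
theorem gauss2F1_eq {a b c : ℝ} {F : ℝ → ℝ} (hF : IsGaussContinuation a b c F) {x : ℝ}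
    (hx : x < 1) : gauss2F1 a b c x = F x := by
  have h : ∃ F : ℝ → ℝ, IsGaussContinuation a b c F := ⟨F, hF⟩
  have hG := h.choose_spec
  rw [gauss2F1, dif_pos h]
  refine hG.1.eqOn_of_preconnected_of_eventuallyEq hF.1 isPreconnected_Iio
    (z₀ := 0) (by simp) ?_ hx
  filter_upwards [Ioo_mem_nhds (show (-1 : ℝ) < 0 by norm_num) zero_lt_one] with y hy
  rw [hG.2 y hy, hF.2 y hy]

/-! ### Probabilistic ingredients -/

/-- The circularly symmetric complex Gaussian law `CN(0, v)` of total variance `v`: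
independent real and imaginary parts, each of variance `v / 2`. -/
def complexGaussian (v : ℝ≥0) : Measure ℂ :=
  ((gaussianReal 0 (v / 2)).prod (gaussianReal 0 (v / 2))).map
    (fun p : ℝ × ℝ => (⟨p.1, p.2⟩ : ℂ))

/-- The random points `x₀, x₁, x₂, …` (in any enumeration) form a Poisson point process with
intensity measure `Λ`: the number of points in a measurable set of finite `Λ`-measure is Poisson
with mean the `Λ`-measure, and numbers of points in disjoint sets are independent. -/
structure IsPoissonProcess {Ω E : Type*} [MeasurableSpace Ω] [MeasurableSpace E]
    (μ : Measure Ω) (Λ : Measure E) (x : ℕ → Ω → E) : Prop where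
  measurable : ∀ k, Measurable (x k)
  poisson : ∀ B : Set E, MeasurableSet B → Λ B ≠ ∞ →
    HasLaw (fun ω => {k | x k ω ∈ B}.encard)
      ((poissonMeasure (Λ B).toNNReal).map (Nat.cast : ℕ → ℕ∞)) μ
  indep : ∀ (m : ℕ) (B : Fin m → Set E), (∀ i, MeasurableSet (B i)) →
    Pairwise (fun i j => Disjoint (B i) (B j)) →
    iIndepFun (fun (i : Fin m) ω => {k | x k ω ∈ B i}.encard) μ

/-- Downlink cellular network seen by a user at the origin who is served by its nearest base
station, at distance `r₀`.  The interfering base stations `x k` form a Poisson point process of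
intensity `lam` outside the disc of radius `r₀`.  The fading coefficients `h₀` (serving link) and
`h k` (interfering links) are `CN(0,1)` (Rayleigh fading), the interfering symbols `s k` are
`CN(0,1)` (Gaussian signalling), the noise `n` is `CN(0,N₀)`; all of them and the point process
are independent. -/
structure IsDownlinkNetwork {Ω : Type*} [MeasurableSpace Ω] (μ : Measure Ω)
    (lam r₀ : ℝ) (N₀ : ℝ≥0) (x : ℕ → Ω → EuclideanSpace ℝ (Fin 2))
    (h s : ℕ → Ω → ℂ) (h₀ n : Ω → ℂ) : Prop where
  points : IsPoissonProcess μ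
    (ENNReal.ofReal lam • (volume : Measure (EuclideanSpace ℝ (Fin 2))).restrict {y | r₀ < ‖y‖}) x
  measurable_h : ∀ k, Measurable (h k)
  measurable_s : ∀ k, Measurable (s k)
  measurable_h₀ : Measurable h₀
  measurable_n : Measurable n
  law_h : ∀ k, HasLaw (h k) (complexGaussian 1) μ
  law_s : ∀ k, HasLaw (s k) (complexGaussian 1) μ
  law_h₀ : HasLaw h₀ (complexGaussian 1) μ
  law_n : HasLaw n (complexGaussian N₀) μ
  indep_marks : iIndepFun (Sum.elim (Sum.elim h s) ![h₀, n]) μ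
  indep_points : IndepFun (fun ω k => x k ω)
    (fun ω i => Sum.elim (Sum.elim h s) ![h₀, n] i ω) μ

/-! ### Received signal, SINR and error probabilities -/

section Network

variable {Ω : Type*} [MeasurableSpace Ω]

/-- The `k`-th contribution `√P s_k h_k r_k^{-η/2}` to the aggregate interference. -/
def interferenceTerm (P η : ℝ) (x : ℕ → Ω → EuclideanSpace ℝ (Fin 2)) (h s : ℕ → Ω → ℂ)
    (k : ℕ) (ω : Ω) : ℂ :=
  ((√P * ‖x k ω‖ ^ (-η / 2) : ℝ) : ℂ) * s k ω * h k ω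

/-- The aggregate interference amplitude `∑ k, √P s_k h_k r_k^{-η/2}`.  The sum is the limit of
its partial sums (for `η ≤ 4` it is not absolutely convergent). -/
def aggInterference (P η : ℝ) (x : ℕ → Ω → EuclideanSpace ℝ (Fin 2)) (h s : ℕ → Ω → ℂ)
    (ω : Ω) : ℂ :=
  limUnder atTop fun K : ℕ => ∑ k ∈ Finset.range K, interferenceTerm P η x h s k ω

/-- The aggregate interference power `∑ k, P |h_k|² r_k^{-η}`. -/
def interferencePower (P η : ℝ) (x : ℕ → Ω → EuclideanSpace ℝ (Fin 2)) (h : ℕ → Ω → ℂ)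
    (ω : Ω) : ℝ :=
  ∑' k, P * ‖h k ω‖ ^ 2 * ‖x k ω‖ ^ (-η)

/-- The conditional signal-to-interference-plus-noise ratio
`P |h₀|² r₀^{-η} / (I_agg + N₀)`. -/
def sinr (P η r₀ : ℝ) (N₀ : ℝ≥0) (x : ℕ → Ω → EuclideanSpace ℝ (Fin 2)) (h : ℕ → Ω → ℂ)
    (h₀ : Ω → ℂ) (ω : Ω) : ℝ :=
  P * ‖h₀ ω‖ ^ 2 * r₀ ^ (-η) / (interferencePower P η x h ω + N₀)

/-- The `M`-QAM weights `w₁ = 2 (√M - 1) / √M` and `w₂ = -((√M - 1) / √M)²`. -/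
def qamWeight (M c : ℕ) : ℝ :=
  if c = 1 then 2 * ((√(M : ℝ) - 1) / √(M : ℝ)) else -((√(M : ℝ) - 1) / √(M : ℝ)) ^ 2

/-- The `M`-QAM factor `β₁ = β₂ = 3 / (2 (M - 1))`. -/
def qamBeta (M : ℕ) : ℝ := 3 / (2 * ((M : ℝ) - 1))

/-- Average symbol error probability: the `M`-QAM symbol error probability
`w₁ erfc √(β₁ Υ) + w₂ erfc² √(β₂ Υ)` of a channel with conditional SINR `Υ`, averaged over the
fading and the aggregate interference power. -/
def asep (μ : Measure Ω) (M : ℕ) (P η r₀ : ℝ) (N₀ : ℝ≥0)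
    (x : ℕ → Ω → EuclideanSpace ℝ (Fin 2)) (h : ℕ → Ω → ℂ) (h₀ : Ω → ℂ) : ℝ :=
  qamWeight M 1 * ∫ ω, erfc √(qamBeta M * sinr P η r₀ N₀ x h h₀ ω) ∂μ +
    qamWeight M 2 * ∫ ω, erfc √(qamBeta M * sinr P η r₀ N₀ x h h₀ ω) ^ 2 ∂μ

/-- The square QAM constellation with `m²` equally spaced points and unit average power
(half the spacing of the grid is `√(3 / (2 (m² - 1)))`). -/
def squareQAM (m : ℕ) (i : Fin m × Fin m) : ℂ :=
  ((√(3 / (2 * ((m : ℝ) ^ 2 - 1))) : ℝ) : ℂ) *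
    ⟨2 * (i.1.val : ℝ) - (m - 1), 2 * (i.2.val : ℝ) - (m - 1)⟩

/-- The received baseband signal `√P s h₀ r₀^{-η/2} + i_agg + n` when the serving base station
sends the symbol `s₀`. -/
def received (P η r₀ : ℝ) (x : ℕ → Ω → EuclideanSpace ℝ (Fin 2)) (h s : ℕ → Ω → ℂ)
    (h₀ n : Ω → ℂ) (s₀ : ℂ) (ω : Ω) : ℂ :=
  ((√P * r₀ ^ (-η / 2) : ℝ) : ℂ) * s₀ * h₀ ω + aggInterference P η x h s ω + n ω

/-- Symbol error probability of the coherent maximum likelihood (that is, minimum distance)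
detector, for equiprobable symbols of the constellation `S`.  The detector errs for the sent
symbol `S i` unless `S i` is strictly closer than every other symbol to the received signal,
symbols being scaled by the known channel `√P r₀^{-η/2} h₀`. -/
def symbolErrorProb {ι : Type*} [Fintype ι] (μ : Measure Ω) (S : ι → ℂ) (P η r₀ : ℝ)
    (x : ℕ → Ω → EuclideanSpace ℝ (Fin 2)) (h s : ℕ → Ω → ℂ) (h₀ n : Ω → ℂ) : ℝ :=
  (Fintype.card ι : ℝ)⁻¹ * ∑ i, μ.real {ω | ∃ j, j ≠ i ∧
    ‖received P η r₀ x h s h₀ n (S i) ω - ((√P * r₀ ^ (-η / 2) : ℝ) : ℂ) * S j * h₀ ω‖ ≤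
      ‖received P η r₀ x h s h₀ n (S i) ω - ((√P * r₀ ^ (-η / 2) : ℝ) : ℂ) * S i * h₀ ω‖}

end Network

/-! ### The integrands of the closed forms -/

/-- The integrand of the `c`-th term for a general path-loss exponent `η`. -/
def asepIntegrand (M : ℕ) (P lam η r₀ : ℝ) (N₀ : ℝ≥0) (c : ℕ) (z : ℝ) : ℝ :=
  erfc (√z * if c = 2 then 1 else 0) / √z *
    Real.exp (-z * (1 + N₀ * r₀ ^ η / (P * qamBeta M)) -
      2 * Real.pi * lam * z * r₀ ^ 2 / (qamBeta M * (η - 2)) *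
        gauss2F1 1 (1 - 2 / η) (2 - 2 / η) (-z / qamBeta M))

/-- The integrand of the `c`-th term for `η = 4`. -/
def asepIntegrandFour (M : ℕ) (P lam r₀ : ℝ) (N₀ : ℝ≥0) (c : ℕ) (z : ℝ) : ℝ :=
  erfc (√z * if c = 2 then 1 else 0) / √z *
    Real.exp (-z * (1 + N₀ * r₀ ^ 4 / (P * qamBeta M)) -
      Real.pi * lam * r₀ ^ 2 * √(z / qamBeta M) * Real.arctan √(z / qamBeta M))

end

/-! ### The complementary error function -/

/-! Two arguments meet in the SINR `Υ`.

Closed forms. For `c = 1, 2` the function `erfc √u ^ c` is `1` minus the integral over `(0, u)` of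
an explicit nonnegative kernel (`erfc_sqrt_pow_eq`), so by Fubini the mean of `erfc √(βΥ) ^ c`
involves only the tail of `Υ` (`integral_erfc_sqrt_pow`). Since `|h₀|²` is exponential and
independent of the interference, `P(Υ > t)` is `exp (-b N₀)` times the Laplace transform of the
interference power at `b = t r₀^η / P`. Averaging over the fading with the points frozen gives the
product of the `(1 + b P r_k^{-η})⁻¹`. Written as the exponential of a sum over the points, this is
averaged by the Laplace functional of the Poisson process
(`IsPoissonProcess.integral_exp_neg_tsum`), which comes from independent Poisson counts by
approximation with simple functions. The remaining radial integral becomes, under `t = v^{-η}`,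
Euler's integral for `₂F₁(1, a; a + 1; ·)` with `a = 1 - 2/η`. Euler's integral has a convergent
Taylor series at each point of `(-∞, 1)` and agrees with the Gauss series on `(-1, 1)`, so it is the
analytic continuation; for `η = 4` it is an arctangent.

Detection. With points and fading frozen, the interference is a square-summable series with
independent Gaussian coefficients. It converges almost surely by martingale convergence, and with
the noise it has law `CN(0, I + N₀)` (`hasLaw_limUnder_add`). This law is rotation invariant, so the
phase of `h₀` can be removed; the decision regions are then rectangles and the two coordinates are
independent (`detection_iff`, `complexGaussian_gridInterval`). A symbol with `d₁`, `d₂` neighbours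
in the two directions is received correctly with probability `(1 - d₁ e / 2)(1 - d₂ e / 2)`, where
`e = erfc √(βΥ)`; averaging over the grid produces the weights `w₁`, `w₂`.

All conditioning is Fubini for the joint law of independent variables (`integral_comp_of_indepFun`,
`ae_of_indepFun`). -/

theorem integrable_exp_neg_sq : Integrable fun t : ℝ => Real.exp (-t ^ 2) := by
  simpa using integrable_exp_neg_mul_sq (b := 1) one_pos

theorem erfc_eq_one_sub (x : ℝ) :
    erfc x = 1 - 2 / √Real.pi * ∫ t in (0 : ℝ)..x, Real.exp (-t ^ 2) := by
  have h1 := intervalIntegral.integral_interval_add_Ioi (a := (0 : ℝ)) (b := x)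
    integrable_exp_neg_sq.integrableOn integrable_exp_neg_sq.integrableOn
  have h2 : ∫ t in Set.Ioi (0 : ℝ), Real.exp (-t ^ 2) = √Real.pi / 2 := by
    simpa using integral_gaussian_Ioi 1
  rw [h2] at h1
  have h3 : √Real.pi ≠ 0 := (Real.sqrt_pos.2 Real.pi_pos).ne'
  rw [erfc, ← sub_eq_of_eq_add' h1.symm]
  field_simp

@[simp] theorem erfc_zero : erfc 0 = 1 := by simp [erfc_eq_one_sub]

theorem hasDerivAt_erfc (x : ℝ) : HasDerivAt erfc (-(2 / √Real.pi * Real.exp (-x ^ 2))) x := by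
  have h : HasDerivAt (fun x : ℝ => ∫ t in (0 : ℝ)..x, Real.exp (-t ^ 2)) (Real.exp (-x ^ 2)) x :=
    intervalIntegral.integral_hasDerivAt_right integrable_exp_neg_sq.intervalIntegrable
      ((by fun_prop : Continuous fun t : ℝ => Real.exp (-t ^ 2)).stronglyMeasurableAtFilter _ _)
      (by fun_prop)
  have := (h.const_mul (2 / √Real.pi)).const_sub 1
  rwa [← funext erfc_eq_one_sub] at this

theorem continuous_erfc : Continuous erfc :=
  continuous_iff_continuousAt.2 fun x => (hasDerivAt_erfc x).continuousAt

theorem erfc_nonneg (x : ℝ) : 0 ≤ erfc x :=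
  mul_nonneg (by positivity) (integral_nonneg fun _ => (Real.exp_pos _).le)

theorem erfc_le_one {x : ℝ} (hx : 0 ≤ x) : erfc x ≤ 1 := by
  rw [erfc_eq_one_sub]
  have : 0 ≤ ∫ t in (0 : ℝ)..x, Real.exp (-t ^ 2) :=
    intervalIntegral.integral_nonneg hx fun _ _ => (Real.exp_pos _).le
  have : 0 ≤ 2 / √Real.pi * ∫ t in (0 : ℝ)..x, Real.exp (-t ^ 2) := by positivity
  linarith

/-- The weight `z ↦ c / √π * erfc (√z) ^ (c - 1) * exp (-z) / √z` (for `c = 1, 2`), which is minus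
the derivative of `z ↦ erfc (√z) ^ c`. -/
noncomputable def erfcKernel (c : ℕ) (z : ℝ) : ℝ :=
  c / √Real.pi * (erfc (√z * if c = 2 then 1 else 0) / √z * Real.exp (-z))

theorem erfcKernel_nonneg (c : ℕ) (z : ℝ) : 0 ≤ erfcKernel c z := by
  have := erfc_nonneg (√z * if c = 2 then 1 else 0)
  unfold erfcKernel
  positivity

theorem measurable_erfcKernel (c : ℕ) : Measurable (erfcKernel c) := by
  have := continuous_erfc.measurable
  unfold erfcKernel
  fun_prop

/-- This is the convergence of the integral for `Γ(1/2)`. -/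
theorem integrableOn_exp_neg_div_sqrt :
    IntegrableOn (fun z : ℝ => Real.exp (-z) / √z) (Set.Ioi 0) := by
  have h := Real.GammaIntegral_convergent (s := 1 / 2) (by norm_num)
  refine h.congr_fun (fun z hz => ?_) measurableSet_Ioi
  have hz : 0 < z := hz
  simp only
  rw [Real.sqrt_eq_rpow, show (1 / 2 - 1 : ℝ) = -(1 / 2) by norm_num, Real.rpow_neg hz.le]
  rfl

theorem erfcKernel_le (c : ℕ) (z : ℝ) :
    erfcKernel c z ≤ c / √Real.pi * (Real.exp (-z) / √z) := by
  have h1 : erfc (√z * if c = 2 then 1 else 0) ≤ 1 := erfc_le_one (by positivity)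
  unfold erfcKernel
  have h2 : erfc (√z * if c = 2 then 1 else 0) / √z * Real.exp (-z) ≤ Real.exp (-z) / √z := by
    rw [div_mul_eq_mul_div]
    exact div_le_div_of_nonneg_right (mul_le_of_le_one_left (Real.exp_pos _).le h1)
      (Real.sqrt_nonneg z)
  exact mul_le_mul_of_nonneg_left h2 (by positivity)

theorem integrableOn_erfcKernel (c : ℕ) : IntegrableOn (erfcKernel c) (Set.Ioi 0) := by
  refine Integrable.mono' (integrableOn_exp_neg_div_sqrt.const_mul (c / √Real.pi))
    (measurable_erfcKernel c).aestronglyMeasurable (ae_of_all _ fun z => ?_)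
  rw [Real.norm_of_nonneg (erfcKernel_nonneg c z)]
  exact erfcKernel_le c z

theorem hasDerivAt_erfc_sqrt_pow {c : ℕ} (hc : c = 1 ∨ c = 2) {z : ℝ} (hz : 0 < z) :
    HasDerivAt (fun z => erfc √z ^ c) (-erfcKernel c z) z := by
  have h1 := ((hasDerivAt_erfc √z).comp z (Real.hasDerivAt_sqrt hz.ne')).pow c
  have hπ : √Real.pi ≠ 0 := (Real.sqrt_pos.2 Real.pi_pos).ne'
  have hz' : √z ≠ 0 := (Real.sqrt_pos.2 hz).ne'
  refine h1.congr_deriv ?_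
  rw [Real.sq_sqrt hz.le]
  rcases hc with rfl | rfl
  · simp [erfcKernel]; field_simp
  · simp [erfcKernel]; field_simp

/-- The derivative blows up like `1/√z` at `0`, so the fundamental theorem is used in the form that
asks for continuity at the endpoints and an integrable derivative inside. The limit `u` is put into
an indicator so that it can be exchanged with an expectation. -/
theorem erfc_sqrt_pow_eq {c : ℕ} (hc : c = 1 ∨ c = 2) {u : ℝ} (hu : 0 ≤ u) :
    erfc √u ^ c = 1 - ∫ z in Set.Ioi 0, (Set.Iio u).indicator (erfcKernel c) z := by
  have h := intervalIntegral.integral_eq_sub_of_hasDerivAt_of_le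
    (f := fun z => erfc √z ^ c) (f' := fun z => -erfcKernel c z) hu
    ((continuous_erfc.comp Real.continuous_sqrt).pow c).continuousOn
    (fun z hz => hasDerivAt_erfc_sqrt_pow hc hz.1)
    (((intervalIntegrable_iff_integrableOn_Ioc_of_le hu).2
      ((integrableOn_erfcKernel c).mono_set Set.Ioc_subset_Ioi_self)).neg)
  rw [intervalIntegral.integral_neg, intervalIntegral.integral_of_le hu] at h
  rw [setIntegral_indicator measurableSet_Iio, Set.Ioi_inter_Iio]
  simp only [Real.sqrt_zero, erfc_zero, one_pow] at h
  rw [← integral_Ioc_eq_integral_Ioo]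
  linarith

/-- The mean of `erfc (√Y) ^ c` in terms of the tail of the law of `Y`. -/
theorem integral_erfc_sqrt_pow {Ω : Type*} [MeasurableSpace Ω] {μ : Measure Ω}
    [IsProbabilityMeasure μ] {c : ℕ} (hc : c = 1 ∨ c = 2) {Y : Ω → ℝ} (hY : Measurable Y)
    (hY0 : ∀ ω, 0 ≤ Y ω) :
    ∫ ω, erfc √(Y ω) ^ c ∂μ =
      1 - ∫ z in Set.Ioi 0, erfcKernel c z * μ.real {ω | z < Y ω} := by
  have hm : MeasurableSet {p : Ω × ℝ | p.2 < Y p.1} :=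
    measurableSet_lt measurable_snd (hY.comp measurable_fst)
  have hint : Integrable (Function.uncurry fun ω z => (Set.Iio (Y ω)).indicator (erfcKernel c) z)
      (μ.prod (volume.restrict (Set.Ioi 0))) := by
    have h1 : Integrable (fun p : Ω × ℝ => erfcKernel c p.2)
        (μ.prod (volume.restrict (Set.Ioi 0))) := by
      simpa using (integrable_const (1 : ℝ) (μ := μ)).mul_prod (integrableOn_erfcKernel c)
    exact h1.indicator hm
  calc ∫ ω, erfc √(Y ω) ^ c ∂μ
      = ∫ ω, (1 - ∫ z in Set.Ioi (0 : ℝ), (Set.Iio (Y ω)).indicator (erfcKernel c) z) ∂μ :=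
        integral_congr_ae (ae_of_all _ fun ω => erfc_sqrt_pow_eq hc (hY0 ω))
    _ = 1 - ∫ ω, (∫ z in Set.Ioi (0 : ℝ), (Set.Iio (Y ω)).indicator (erfcKernel c) z) ∂μ := by
        have := integral_sub (integrable_const (1 : ℝ)) hint.integral_prod_left
        simpa using this
    _ = _ := by
        rw [integral_integral_swap hint]
        congr 1
        refine integral_congr_ae (ae_of_all _ fun z => ?_)
        have : (fun ω => (Set.Iio (Y ω)).indicator (erfcKernel c) z) =
            {ω | z < Y ω}.indicator fun _ => erfcKernel c z := by
          ext ω; simp [Set.indicator]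
        simp only [this]
        rw [integral_indicator (measurableSet_lt measurable_const hY)]
        simp [mul_comm]

/-- The upper tail of a centred Gaussian law. -/
theorem gaussianReal_Ioi {v : ℝ≥0} (hv : v ≠ 0) (x : ℝ) :
    (gaussianReal 0 v).real (Set.Ioi (√(2 * v) * x)) = erfc x / 2 := by
  have hv' : (0 : ℝ) < v := by positivity
  have hs : 0 < √(2 * v : ℝ) := by positivity
  rw [measureReal_def, gaussianReal_apply_eq_integral _ hv, ENNReal.toReal_ofReal
    (integral_nonneg fun _ => gaussianPDFReal_nonneg _ _ _)]
  have hsub := integral_comp_mul_left_Ioi (gaussianPDFReal 0 v) x hs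
  rw [eq_inv_smul_iff₀ hs.ne'] at hsub
  rw [← hsub]
  rw [erfc, smul_eq_mul, ← integral_const_mul, mul_div_right_comm, ← integral_const_mul]
  refine integral_congr_ae (ae_of_all _ fun t => ?_)
  simp only [gaussianPDFReal, sub_zero, mul_pow, Real.sq_sqrt (by positivity : (0:ℝ) ≤ 2 * v)]
  rw [show -(2 * (v:ℝ) * t ^ 2) / (2 * v) = -t ^ 2 by field_simp,
    show 2 * Real.pi * (v:ℝ) = 2 * v * Real.pi by ring, Real.sqrt_mul (by positivity) Real.pi]
  have hπ : √Real.pi ≠ 0 := (Real.sqrt_pos.2 Real.pi_pos).ne'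
  generalize √(2 * (v : ℝ)) = a at hs
  field_simp

/-! ### The Gauss hypergeometric function `₂F₁(1, b; b + 1; x)` -/

/-- Euler's integral for `₂F₁(1, b; b + 1; x)`. -/
noncomputable def eulerIntegral (b x : ℝ) : ℝ :=
  b * ∫ t in Set.Ioc (0 : ℝ) 1, t ^ (b - 1) * (1 - x * t)⁻¹

theorem integrableOn_rpow_sub_one {b : ℝ} (hb : 0 < b) :
    IntegrableOn (fun t : ℝ => t ^ (b - 1)) (Set.Ioc 0 1) :=
  (intervalIntegrable_iff_integrableOn_Ioc_of_le zero_le_one).1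
    (intervalIntegral.intervalIntegrable_rpow' (by linarith))

theorem integral_rpow_add_sub_one {b : ℝ} (hb : 0 < b) (n : ℕ) :
    ∫ t in Set.Ioc (0 : ℝ) 1, t ^ (b - 1) * t ^ n = (b + n)⁻¹ := by
  have h1 : ∫ t in Set.Ioc (0 : ℝ) 1, t ^ (b - 1) * t ^ n =
      ∫ t in Set.Ioc (0 : ℝ) 1, t ^ (b - 1 + n) := by
    refine setIntegral_congr_fun measurableSet_Ioc fun t ht => ?_
    rw [Real.rpow_add ht.1, Real.rpow_natCast]
  have hn : (0 : ℝ) ≤ n := n.cast_nonneg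
  rw [h1, ← intervalIntegral.integral_of_le zero_le_one, integral_rpow (Or.inl (by linarith)),
    Real.zero_rpow (by linarith)]
  simp [show b - 1 + n + 1 = b + n by ring]

theorem min_le_one_sub_mul {x t : ℝ} (ht : t ∈ Set.Ioc (0 : ℝ) 1) : min 1 (1 - x) ≤ 1 - x * t := by
  rcases le_total 0 x with hx | hx
  · exact (min_le_right _ _).trans (by nlinarith [ht.2])
  · exact (min_le_left _ _).trans (by nlinarith [ht.1])

/-- Taylor expansion of Euler's integral at an arbitrary point of `(-∞, 1)`. -/
theorem hasSum_eulerIntegral {b x y : ℝ} (hb : 0 < b) (hx : x < 1) (hy : |y| < min 1 (1 - x)) :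
    HasSum (fun n : ℕ => y ^ n * (b * ∫ t in Set.Ioc (0 : ℝ) 1,
      t ^ (b - 1) * (t ^ n * ((1 - x * t)⁻¹) ^ (n + 1)))) (eulerIntegral b (x + y)) := by
  -- `m` bounds `1 - x t` from below on `(0, 1]` whatever the sign of `x`, so the terms are
  -- dominated by a geometric series of ratio `|y| / m`.
  set m := min 1 (1 - x) with hm
  have hm0 : 0 < m := lt_min one_pos (by linarith)
  have hbound : ∀ (n : ℕ) (t : ℝ), t ∈ Set.Ioc (0 : ℝ) 1 →
      ‖y ^ n * (t ^ (b - 1) * (t ^ n * ((1 - x * t)⁻¹) ^ (n + 1)))‖ ≤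
        (|y| / m) ^ n * m⁻¹ * t ^ (b - 1) := by
    intro n t ht
    have h1 : 0 < 1 - x * t := hm0.trans_le (min_le_one_sub_mul ht)
    have h2 : (1 - x * t)⁻¹ ≤ m⁻¹ := inv_anti₀ hm0 (min_le_one_sub_mul ht)
    have h3 : (0 : ℝ) ≤ t ^ (b - 1) := Real.rpow_nonneg ht.1.le _
    rw [norm_mul, norm_pow, Real.norm_eq_abs, Real.norm_of_nonneg
      (mul_nonneg h3 (mul_nonneg (pow_nonneg ht.1.le n) (by positivity)))]
    have h4 : t ^ n * ((1 - x * t)⁻¹) ^ (n + 1) ≤ 1 * (m⁻¹) ^ (n + 1) := by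
      gcongr
      exact pow_le_one₀ ht.1.le ht.2
    calc |y| ^ n * (t ^ (b - 1) * (t ^ n * ((1 - x * t)⁻¹) ^ (n + 1)))
        ≤ |y| ^ n * (t ^ (b - 1) * (1 * (m⁻¹) ^ (n + 1))) := by gcongr
      _ = _ := by rw [div_pow, pow_succ, inv_pow]; field_simp
  have hmeas : ∀ n : ℕ, Measurable fun t : ℝ =>
      y ^ n * (t ^ (b - 1) * (t ^ n * ((1 - x * t)⁻¹) ^ (n + 1))) := fun n => by fun_prop
  have hint : ∀ n : ℕ, IntegrableOn (fun t : ℝ =>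
      y ^ n * (t ^ (b - 1) * (t ^ n * ((1 - x * t)⁻¹) ^ (n + 1)))) (Set.Ioc 0 1) := fun n =>
    Integrable.mono' ((integrableOn_rpow_sub_one hb).const_mul ((|y| / m) ^ n * m⁻¹))
      (hmeas n).aestronglyMeasurable
      ((ae_restrict_iff' measurableSet_Ioc).2 (ae_of_all _ (hbound n)))
  have hsum : Summable fun n : ℕ => ∫ t in Set.Ioc (0 : ℝ) 1,
      ‖y ^ n * (t ^ (b - 1) * (t ^ n * ((1 - x * t)⁻¹) ^ (n + 1)))‖ := by
    have hg : Summable fun n : ℕ =>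
        (|y| / m) ^ n * (m⁻¹ * ∫ t in Set.Ioc (0 : ℝ) 1, t ^ (b - 1)) :=
      (summable_geometric_of_lt_one (by positivity) ((div_lt_one hm0).2 hy)).mul_right _
    refine Summable.of_nonneg_of_le (fun n => integral_nonneg fun _ => norm_nonneg _)
      (fun n => ?_) hg
    rw [← mul_assoc, ← integral_const_mul]
    exact setIntegral_mono_on (hint n).norm ((integrableOn_rpow_sub_one hb).const_mul _)
      measurableSet_Ioc (hbound n)
  have h := (hasSum_integral_of_summable_integral_norm hint hsum).mul_left b
  have hR : ∫ t in Set.Ioc (0 : ℝ) 1,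
      ∑' n : ℕ, y ^ n * (t ^ (b - 1) * (t ^ n * ((1 - x * t)⁻¹) ^ (n + 1))) =
      ∫ t in Set.Ioc (0 : ℝ) 1, t ^ (b - 1) * (1 - (x + y) * t)⁻¹ := by
    refine setIntegral_congr_fun measurableSet_Ioc fun t ht => ?_
    have h1 : m ≤ 1 - x * t := min_le_one_sub_mul ht
    have h1' : 0 < 1 - x * t := hm0.trans_le h1
    have h2 : |y * t| < 1 - x * t := by
      rw [abs_mul, abs_of_pos ht.1]
      calc |y| * t ≤ |y| * 1 := by gcongr; exact ht.2
        _ < m := by simpa using hy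
        _ ≤ _ := h1
    have h3 : 1 - (x + y) * t ≠ 0 := by nlinarith [abs_lt.1 h2]
    -- With `q = y t / (1 - x t)` one has `1 - (x + y) t = (1 - x t)(1 - q)`: under the integral the
    -- expansion is geometric in `q`.
    have hq : ‖y * t * (1 - x * t)⁻¹‖ < 1 := by
      rw [norm_mul, norm_inv, Real.norm_eq_abs, Real.norm_of_nonneg h1'.le, ← div_eq_mul_inv]
      exact (div_lt_one h1').2 h2
    have h4 := (hasSum_geometric_of_norm_lt_one hq).mul_left (t ^ (b - 1) * (1 - x * t)⁻¹)
    have h5 : ∑' n : ℕ, y ^ n * (t ^ (b - 1) * (t ^ n * ((1 - x * t)⁻¹) ^ (n + 1))) =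
        t ^ (b - 1) * (1 - x * t)⁻¹ * (1 - y * t * (1 - x * t)⁻¹)⁻¹ := by
      rw [← h4.tsum_eq]
      refine tsum_congr fun n => ?_
      rw [mul_pow, mul_pow, pow_succ]; ring
    simp only [h5]
    rw [mul_assoc, ← mul_inv]
    congr 2
    field_simp
    ring
  rw [hR] at h
  rw [eulerIntegral]
  convert! h using 2 with n
  rw [integral_const_mul]
  ring

theorem analyticOnNhd_eulerIntegral {b : ℝ} (hb : 0 < b) :
    AnalyticOnNhd ℝ (eulerIntegral b) (Set.Iio 1) := by
  intro x hx
  have hx : x < 1 := hx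
  refine ⟨FormalMultilinearSeries.ofScalars ℝ fun n : ℕ => b * ∫ t in Set.Ioc (0 : ℝ) 1,
    t ^ (b - 1) * (t ^ n * ((1 - x * t)⁻¹) ^ (n + 1)), hasFPowerSeriesAt_iff.2 ?_⟩
  have hm0 : 0 < min 1 (1 - x) := lt_min one_pos (by linarith)
  filter_upwards [Metric.ball_mem_nhds (0 : ℝ) hm0] with y hy
  simp only [FormalMultilinearSeries.coeff_ofScalars, smul_eq_mul]
  exact hasSum_eulerIntegral hb hx (by simpa using hy)

/-- Both sides are `(b)ₙ₊₁`. Hence `(b)ₙ / (b + 1)ₙ = b / (b + n)`, which is `b` times the moment `∫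
t^{b - 1 + n}` over `(0, 1]`; since `(1)ₙ` cancels `n!`, this matches the Gauss series with Euler's
integral term by term. -/
theorem eval_ascPochhammer_mul_add (b : ℝ) (n : ℕ) :
    (ascPochhammer ℝ n).eval b * (b + n) = b * (ascPochhammer ℝ n).eval (b + 1) := by
  induction n with
  | zero => simp
  | succ n ih =>
    rw [ascPochhammer_succ_eval, ascPochhammer_succ_eval, ih]
    push_cast
    ring

theorem ordinaryHypergeometric_one_eq {b x : ℝ} (hb : 0 < b) (hx : x ∈ Set.Ioo (-1 : ℝ) 1) :
    ordinaryHypergeometric 1 b (b + 1) x = eulerIntegral b x := by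
  have h := hasSum_eulerIntegral (x := 0) (y := x) hb zero_lt_one (by simpa [abs_lt] using hx)
  rw [zero_add] at h
  rw [← h.tsum_eq, ordinaryHypergeometric_eq_tsum]
  refine tsum_congr fun n => ?_
  have h1 : (n.factorial : ℝ) ≠ 0 := by positivity
  have h2 : (ascPochhammer ℝ n).eval (b + 1) ≠ 0 := (ascPochhammer_pos n _ (by linarith)).ne'
  have h3 : b + n ≠ 0 := by positivity
  have h4 := eval_ascPochhammer_mul_add b n
  simp only [zero_mul, sub_zero, inv_one, one_pow, mul_one, integral_rpow_add_sub_one hb,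
    ascPochhammer_eval_one, smul_eq_mul, inv_mul_cancel₀ h1, one_mul]
  field_simp
  linear_combination x ^ n * h4

theorem isGaussContinuation_eulerIntegral {b : ℝ} (hb : 0 < b) :
    IsGaussContinuation 1 b (b + 1) (eulerIntegral b) :=
  ⟨analyticOnNhd_eulerIntegral hb, fun _ hx => (ordinaryHypergeometric_one_eq hb hx).symm⟩

theorem gauss2F1_one_eq {b x : ℝ} (hb : 0 < b) (hx : x < 1) :
    gauss2F1 1 b (b + 1) x = eulerIntegral b x :=
  gauss2F1_eq (isGaussContinuation_eulerIntegral hb) hx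

/-- `₂F₁(1, 1/2; 3/2; -θ) = arctan √θ / √θ`. -/
theorem eulerIntegral_half {θ : ℝ} (hθ : 0 < θ) :
    eulerIntegral (1 / 2) (-θ) = Real.arctan √θ / √θ := by
  have hs : 0 < √θ := Real.sqrt_pos.2 hθ
  -- The substitution `t = x²` absorbs the singularity `t^{-1/2}` and leaves the derivative of an
  -- arctangent.
  have h := integral_comp_rpow_Ioi
    (fun t : ℝ => (Set.Ioc (0 : ℝ) 1).indicator (fun t => t ^ (1 / 2 - 1 : ℝ) * (1 - -θ * t)⁻¹) t)
    (two_ne_zero (α := ℝ))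
  rw [setIntegral_indicator measurableSet_Ioc, Set.inter_eq_self_of_subset_right
    Set.Ioc_subset_Ioi_self] at h
  rw [eulerIntegral, ← h]
  have h2 : ∫ x in Set.Ioi (0 : ℝ), (|(2 : ℝ)| * x ^ ((2 : ℝ) - 1)) • (Set.Ioc (0 : ℝ) 1).indicator
      (fun t => t ^ (1 / 2 - 1 : ℝ) * (1 - -θ * t)⁻¹) (x ^ (2 : ℝ)) =
      ∫ x in Set.Ioi (0 : ℝ), (Set.Ioc (0 : ℝ) 1).indicator
        (fun x => 2 * (1 + (√θ * x) ^ 2)⁻¹) x := by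
    refine setIntegral_congr_fun measurableSet_Ioi fun x hx => ?_
    have hx : 0 < x := hx
    have hmem : x ^ (2 : ℝ) ∈ Set.Ioc (0 : ℝ) 1 ↔ x ∈ Set.Ioc (0 : ℝ) 1 := by
      simp [hx, sq_le_one_iff₀ hx.le]
    by_cases hm : x ∈ Set.Ioc (0 : ℝ) 1
    · simp only [Set.indicator_of_mem hm, Set.indicator_of_mem (hmem.2 hm), smul_eq_mul]
      rw [← Real.rpow_mul hx.le, mul_pow, Real.sq_sqrt hθ.le]
      norm_num [Real.rpow_neg_one]
      field_simp
    · simp only [Set.indicator_of_notMem hm, Set.indicator_of_notMem (mt hmem.1 hm), smul_zero]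
  rw [h2, setIntegral_indicator measurableSet_Ioc, Set.inter_eq_self_of_subset_right
    Set.Ioc_subset_Ioi_self, integral_const_mul, ← intervalIntegral.integral_of_le zero_le_one,
    intervalIntegral.integral_comp_mul_left (fun y => (1 + y ^ 2)⁻¹) hs.ne']
  simp
  field_simp

/-- Euler's integral after the substitution `t = v ^ (-η)`. -/
theorem integral_Ioi_eq_eulerIntegral {η θ : ℝ} (hη : 2 < η) (hθ : 0 ≤ θ) :
    ∫ v in Set.Ioi (1 : ℝ), v * (1 - (1 + θ * v ^ (-η))⁻¹) =
      θ / (η - 2) * eulerIntegral (1 - 2 / η) (-θ) := by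
  have hη0 : 0 < η := by linarith
  have hη2 : η - 2 ≠ 0 := by linarith
  -- The open interval is used because `x ↦ x ^ (-η)` pulls `(0, 1)` back exactly to `(1, ∞)`.
  have h := integral_comp_rpow_Ioi
    (fun t : ℝ => (Set.Ioo (0 : ℝ) 1).indicator
      (fun t => t ^ (1 - 2 / η - 1 : ℝ) * (1 - -θ * t)⁻¹) t) (neg_ne_zero.2 hη0.ne')
  rw [setIntegral_indicator measurableSet_Ioo, Set.inter_eq_self_of_subset_right
    Set.Ioo_subset_Ioi_self, ← integral_Ioc_eq_integral_Ioo] at h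
  rw [eulerIntegral, ← h]
  have h2 : ∫ x in Set.Ioi (0 : ℝ), (|(-η)| * x ^ (-η - 1)) • (Set.Ioo (0 : ℝ) 1).indicator
      (fun t => t ^ (1 - 2 / η - 1 : ℝ) * (1 - -θ * t)⁻¹) (x ^ (-η)) =
      ∫ x in Set.Ioi (0 : ℝ), (Set.Ioi (1 : ℝ)).indicator
        (fun x => η * (x * (x ^ (-η) * (1 + θ * x ^ (-η))⁻¹))) x := by
    refine setIntegral_congr_fun measurableSet_Ioi fun x hx => ?_
    have hx : 0 < x := hx
    have hmem : x ^ (-η) ∈ Set.Ioo (0 : ℝ) 1 ↔ x ∈ Set.Ioi (1 : ℝ) := by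
      simp [Real.rpow_pos_of_pos hx, Real.rpow_lt_one_iff_of_pos hx, hη0, hη0.not_gt]
    by_cases hm : x ∈ Set.Ioi (1 : ℝ)
    · simp only [Set.indicator_of_mem hm, Set.indicator_of_mem (hmem.2 hm), smul_eq_mul]
      rw [← Real.rpow_mul hx.le, show -η * (1 - 2 / η - 1) = 2 by field_simp; ring,
        abs_neg, abs_of_pos hη0, Real.rpow_sub_one hx.ne', Real.rpow_two]
      rw [neg_mul, sub_neg_eq_add]
      field_simp
    · simp only [Set.indicator_of_notMem hm, Set.indicator_of_notMem (mt hmem.1 hm), smul_zero]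
  rw [h2, setIntegral_indicator measurableSet_Ioi, Set.inter_eq_self_of_subset_right
    (Set.Ioi_subset_Ioi zero_le_one), integral_const_mul,
    show ∀ I : ℝ, θ / (η - 2) * ((1 - 2 / η) * (η * I)) = θ * I by intro I; field_simp,
    ← integral_const_mul]
  refine setIntegral_congr_fun measurableSet_Ioi fun x hx => ?_
  have hx : 0 < x := zero_lt_one.trans hx
  have h3 : 0 < 1 + θ * x ^ (-η) := by positivity
  field_simp
  ring

/-! ### Radial integrals in the plane -/

theorem integral_norm_euclideanPlane (f : ℝ → ℝ) :
    ∫ y : EuclideanSpace ℝ (Fin 2), f ‖y‖ = 2 * Real.pi * ∫ r in Set.Ioi (0 : ℝ), r * f r := by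
  rw [integral_fun_norm_addHaar]
  simp [measureReal_def, EuclideanSpace.volume_ball_fin_two, Real.pi_pos.le, mul_assoc]

theorem integral_norm_complex (f : ℝ → ℝ) :
    ∫ w : ℂ, f ‖w‖ = 2 * Real.pi * ∫ r in Set.Ioi (0 : ℝ), r * f r := by
  rw [integral_fun_norm_addHaar]
  simp [measureReal_def, Complex.volume_ball, Complex.finrank_real_complex, mul_assoc]

/-- In polar coordinates the integrand is `r^{1 - η}`: `η > 2` controls infinity, and the excluded
disc removes the singularity at the origin. -/
theorem integrableOn_norm_rpow_neg {η r₀ : ℝ} (hη : 2 < η) (hr₀ : 0 < r₀) :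
    IntegrableOn (fun y : EuclideanSpace ℝ (Fin 2) => ‖y‖ ^ (-η)) {y | r₀ < ‖y‖} := by
  have hm : MeasurableSet {y : EuclideanSpace ℝ (Fin 2) | r₀ < ‖y‖} :=
    measurableSet_lt measurable_const measurable_norm
  rw [← integrable_indicator_iff hm]
  have h := integrable_fun_norm_addHaar (volume : Measure (EuclideanSpace ℝ (Fin 2)))
    (f := (Set.Ioi r₀).indicator fun r : ℝ => r ^ (-η))
  have h1 : (fun y : EuclideanSpace ℝ (Fin 2) => (Set.Ioi r₀).indicator (fun r : ℝ => r ^ (-η)) ‖y‖)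
      = {y | r₀ < ‖y‖}.indicator fun y => ‖y‖ ^ (-η) := by
    ext y; simp [Set.indicator]
  rw [← h1, h]
  have h2 : (fun r : ℝ => r ^ (Module.finrank ℝ (EuclideanSpace ℝ (Fin 2)) - 1) •
      (Set.Ioi r₀).indicator (fun r : ℝ => r ^ (-η)) r) =
      (Set.Ioi r₀).indicator fun r : ℝ => r ^ (1 - η) := by
    ext r
    by_cases hr : r ∈ Set.Ioi r₀
    · have hr' : 0 < r := hr₀.trans hr
      simp only [Set.indicator_of_mem hr, finrank_euclideanSpace, Fintype.card_fin, smul_eq_mul]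
      rw [Real.rpow_sub hr', Real.rpow_neg hr'.le, Real.rpow_one]
      simp [div_eq_mul_inv]
    · simp [hr]
  rw [h2]
  exact ((integrable_indicator_iff measurableSet_Ioi).2
    (integrableOn_Ioi_rpow_of_lt (by linarith) hr₀)).integrableOn

/-- Polar coordinates give `2π`, and the scaling `r = r₀ v` gives `r₀²` and a dimensionless integral
over `v > 1`. -/
theorem integral_plane_eq_eulerIntegral {η r₀ θ : ℝ} (hη : 2 < η) (hr₀ : 0 < r₀) (hθ : 0 ≤ θ) :
    ∫ y in {y : EuclideanSpace ℝ (Fin 2) | r₀ < ‖y‖}, (1 - (1 + θ * (‖y‖ / r₀) ^ (-η))⁻¹) =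
      2 * Real.pi * r₀ ^ 2 * (θ / (η - 2) * eulerIntegral (1 - 2 / η) (-θ)) := by
  have hm : MeasurableSet {y : EuclideanSpace ℝ (Fin 2) | r₀ < ‖y‖} :=
    measurableSet_lt measurable_const measurable_norm
  rw [← integral_indicator hm]
  have h := integral_norm_euclideanPlane
    ((Set.Ioi r₀).indicator fun r => 1 - (1 + θ * (r / r₀) ^ (-η))⁻¹)
  have h1 : (fun y : EuclideanSpace ℝ (Fin 2) =>
      (Set.Ioi r₀).indicator (fun r => 1 - (1 + θ * (r / r₀) ^ (-η))⁻¹) ‖y‖) =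
      {y | r₀ < ‖y‖}.indicator fun y => 1 - (1 + θ * (‖y‖ / r₀) ^ (-η))⁻¹ := by
    ext y; simp [Set.indicator]
  have h2 : (fun r : ℝ => r * (Set.Ioi r₀).indicator (fun r => 1 - (1 + θ * (r / r₀) ^ (-η))⁻¹) r) =
      (Set.Ioi r₀).indicator fun r => r * (1 - (1 + θ * (r / r₀) ^ (-η))⁻¹) := by
    ext r; simp [Set.indicator]
  rw [h1, h2, setIntegral_indicator measurableSet_Ioi, Set.inter_eq_self_of_subset_right
    (Set.Ioi_subset_Ioi hr₀.le)] at h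
  rw [h, ← integral_Ioi_eq_eulerIntegral hη hθ]
  have h3 := integral_comp_mul_left_Ioi
    (fun r : ℝ => r * (1 - (1 + θ * (r / r₀) ^ (-η))⁻¹)) 1 hr₀
  rw [eq_inv_smul_iff₀ hr₀.ne', mul_one] at h3
  rw [← h3, smul_eq_mul, mul_assoc (2 * Real.pi), ← integral_const_mul r₀,
    ← integral_const_mul (r₀ ^ 2)]
  refine congrArg (2 * Real.pi * ·) ?_
  refine integral_congr_ae (ae_of_all _ fun v => ?_)
  simp only [mul_div_cancel_left₀ v hr₀.ne']
  ring

/-! ### Poisson laws and Poisson processes -/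

/-- The weights satisfy `(n + 1) p_{n+1} = r p_n`, so shifting the index leaves `r` times the total
mass. -/
theorem lintegral_natCast_poissonMeasure (r : ℝ≥0) :
    ∫⁻ n, (n : ℝ≥0∞) ∂poissonMeasure r = r := by
  rw [poissonMeasure, lintegral_sum_measure]
  simp only [lintegral_smul_measure, lintegral_dirac, smul_eq_mul]
  have h1 : ∀ n : ℕ, ENNReal.ofReal (Real.exp (-r) * r ^ (n + 1) / (n + 1).factorial) *
      ((n + 1 : ℕ) : ℝ≥0∞) = r * ENNReal.ofReal (Real.exp (-r) * r ^ n / n.factorial) := by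
    intro n
    rw [← ENNReal.ofReal_natCast, ← ENNReal.ofReal_mul (by positivity), ← ENNReal.ofReal_coe_nnreal,
      ← ENNReal.ofReal_mul (by positivity), Nat.factorial_succ]
    congr 1
    push_cast
    field_simp
    ring
  rw [tsum_eq_zero_add' ENNReal.summable]
  simp only [h1]
  rw [ENNReal.tsum_mul_left, ← ENNReal.ofReal_tsum_of_nonneg (fun _ => by positivity)
    (hasSum_one_poissonMeasure r).summable, (hasSum_one_poissonMeasure r).tsum_eq]
  simp

theorem integral_exp_neg_mul_poissonMeasure (r : ℝ≥0) (c : ℝ) :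
    ∫ n, Real.exp (-(c * (n : ℝ))) ∂poissonMeasure r = Real.exp (-((1 - Real.exp (-c)) * r)) := by
  rw [integral_poissonMeasure]
  have h := (NormedSpace.expSeries_div_hasSum_exp (Real.exp (-c) * r)).mul_left (Real.exp (-r))
  rw [← Real.exp_eq_exp_ℝ, ← Real.exp_add] at h
  rw [show -((1 - Real.exp (-c)) * (r : ℝ)) = -r + Real.exp (-c) * r by ring, ← h.tsum_eq]
  refine tsum_congr fun n => ?_
  rw [mul_pow, ← Real.exp_nat_mul, smul_eq_mul, show (n : ℝ) * -c = -(c * n) by ring]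
  ring

namespace IsPoissonProcess

variable {Ω E : Type*} [MeasurableSpace Ω] [MeasurableSpace E] {μ : Measure Ω} {Λ : Measure E}
  {x : ℕ → Ω → E}

/-- Both sides are the mean number of points in `B`: one by Tonelli for the indicators, the other as
the mean of a Poisson law. -/
theorem tsum_measure_preimage (hx : IsPoissonProcess μ Λ x) {B : Set E} (hB : MeasurableSet B)
    (hΛ : Λ B ≠ ∞) : ∑' k, μ (x k ⁻¹' B) = Λ B := by
  have h1 := (hx.poisson B hB hΛ).lintegral_comp (f := ENat.toENNReal) (by fun_prop)
  rw [lintegral_map (by fun_prop) (by fun_prop)] at h1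
  simp only [ENat.toENNReal_coe] at h1
  rw [lintegral_natCast_poissonMeasure, ENNReal.coe_toNNReal hΛ] at h1
  rw [← h1]
  have h2 : ∀ ω, (({k | x k ω ∈ B}.encard : ℕ∞) : ℝ≥0∞) =
      ∑' k, (x k ⁻¹' B).indicator (fun _ => (1 : ℝ≥0∞)) ω := by
    intro ω
    rw [← ENNReal.tsum_set_one, tsum_subtype {k | x k ω ∈ B} (fun _ => (1 : ℝ≥0∞))]
    rfl
  simp only [h2]
  rw [lintegral_tsum fun k => (measurable_const.indicator (hx.measurable k hB)).aemeasurable]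
  refine tsum_congr fun k => ?_
  rw [lintegral_indicator (hx.measurable k hB)]
  simp

/-- The mean measure of a Poisson process is its intensity measure. -/
theorem sum_map_eq (hx : IsPoissonProcess μ Λ x) [SigmaFinite Λ] :
    Measure.sum (fun k => μ.map (x k)) = Λ := by
  -- Counts are prescribed only on sets of finite intensity, hence the localisation to spanning
  -- sets.
  refine (Measure.ext_iff_of_iUnion_eq_univ (iUnion_spanningSets Λ)).2 fun i => ?_
  ext B hB
  have hm := hB.inter (measurableSet_spanningSets Λ i)
  rw [Measure.restrict_apply hB, Measure.restrict_apply hB, Measure.sum_apply _ hm,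
    ← hx.tsum_measure_preimage hm
      ((measure_mono Set.inter_subset_right).trans_lt (measure_spanningSets_lt_top Λ i)).ne]
  exact tsum_congr fun k => Measure.map_apply (hx.measurable k) hm

/-- Campbell's theorem. -/
theorem lintegral_tsum_eq (hx : IsPoissonProcess μ Λ x) [SigmaFinite Λ] {g : E → ℝ≥0∞}
    (hg : Measurable g) : ∫⁻ ω, ∑' k, g (x k ω) ∂μ = ∫⁻ y, g y ∂Λ := by
  rw [lintegral_tsum (f := fun k ω => g (x k ω))
    fun k => (hg.comp (hx.measurable k)).aemeasurable]
  conv_rhs => rw [← hx.sum_map_eq, lintegral_sum_measure]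
  exact tsum_congr fun k => (lintegral_map hg (hx.measurable k)).symm

/-- By Campbell's theorem `∑ |g (x k)|` has finite mean, hence is almost surely finite. -/
theorem ae_summable (hx : IsPoissonProcess μ Λ x) [SigmaFinite Λ] {g : E → ℝ}
    (hg : Measurable g) (hgi : Integrable g Λ) : ∀ᵐ ω ∂μ, Summable fun k => g (x k ω) := by
  have h1 := hx.lintegral_tsum_eq hg.enorm
  have h2 : ∫⁻ ω, ∑' k, ‖g (x k ω)‖ₑ ∂μ ≠ ∞ := by rw [h1]; exact hgi.2.ne
  filter_upwards [ae_lt_top (by have := hx.measurable; fun_prop) h2] with ω hω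
  refine Summable.of_norm ?_
  simpa using ENNReal.summable_toReal hω.ne

/-- The mean number of points in the complement of `B` is zero. -/
theorem ae_forall_mem (hx : IsPoissonProcess μ Λ x) {B : Set E} (hB : MeasurableSet B)
    (hΛ : Λ Bᶜ = 0) : ∀ᵐ ω ∂μ, ∀ k, x k ω ∈ B := by
  have h := hx.tsum_measure_preimage hB.compl (by simp [hΛ])
  rw [hΛ, ENNReal.tsum_eq_zero] at h
  exact ae_all_iff.2 fun k => ae_iff.2 (h k)

theorem ae_finite (hx : IsPoissonProcess μ Λ x) {B : Set E} (hB : MeasurableSet B)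
    (hΛ : Λ B ≠ ∞) : ∀ᵐ ω ∂μ, {k | x k ω ∈ B}.Finite := by
  have h := ((hx.poisson B hB hΛ).ae_iff (p := fun n => n ≠ ⊤) (by fun_prop)).2 ?_
  · filter_upwards [h] with ω hω
    exact Set.encard_ne_top_iff.1 hω
  · rw [ae_map_iff (by fun_prop) (MeasurableSet.of_discrete)]
    exact ae_of_all _ fun n => ENat.natCast_ne_top n

/-- Laplace transform of the numbers of points in finitely many disjoint sets. -/
theorem integral_exp_neg_sum (hx : IsPoissonProcess μ Λ x) {m : ℕ} {B : Fin m → Set E}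
    (hB : ∀ i, MeasurableSet (B i)) (hΛ : ∀ i, Λ (B i) ≠ ∞)
    (hd : Pairwise fun i j => Disjoint (B i) (B j)) (c : Fin m → ℝ) :
    ∫ ω, Real.exp (-∑ i, c i * ({k | x k ω ∈ B i}.ncard : ℝ)) ∂μ =
      Real.exp (-∑ i, (1 - Real.exp (-c i)) * Λ.real (B i)) := by
  have h1 := hx.indep m B hB hd
  -- `ncard` is the `toNat` of `encard`; its default value `0` at `⊤` is harmless because the law of
  -- the count is carried by `ℕ`.
  have h2 := h1.comp (fun i n => Real.exp (-(c i * (n.toNat : ℝ)))) (fun i => by fun_prop)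
  have h3 := h2.integral_fun_prod_eq_prod_integral fun i =>
    ((by fun_prop : Measurable fun n : ℕ∞ => Real.exp (-(c i * (n.toNat : ℝ)))).comp_aemeasurable
      (hx.poisson (B i) (hB i) (hΛ i)).aemeasurable).aestronglyMeasurable
  rw [← Finset.sum_neg_distrib, Real.exp_sum]
  simp only [← Finset.sum_neg_distrib, Real.exp_sum]
  refine h3.trans (Finset.prod_congr rfl fun i _ => ?_)
  have h4 := (hx.poisson (B i) (hB i) (hΛ i)).integral_comp
    (f := fun n : ℕ∞ => Real.exp (-(c i * (n.toNat : ℝ))))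
    (by fun_prop : Measurable fun n : ℕ∞ => Real.exp (-(c i * (n.toNat : ℝ)))).aestronglyMeasurable
  refine h4.trans ?_
  rw [integral_map (by fun_prop)
    (by fun_prop : Measurable fun n : ℕ∞ => Real.exp (-(c i * (n.toNat : ℝ)))).aestronglyMeasurable]
  simpa [measureReal_def, ENNReal.coe_toNNReal_eq_toReal] using
    integral_exp_neg_mul_poissonMeasure (Λ (B i)).toNNReal (c i)

/-- Grouping the points by the value of `f` turns the sum into `∑ c · N(f⁻¹{c})`, a combination of
independent Poisson counts. -/
theorem integral_exp_neg_tsum_simpleFunc (hx : IsPoissonProcess μ Λ x) (f : SimpleFunc E ℝ)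
    (hf : Integrable f Λ) :
    ∫ ω, Real.exp (-∑' k, f (x k ω)) ∂μ = Real.exp (-∫ y, (1 - Real.exp (-f y)) ∂Λ) := by
  classical
  -- The fibre over `0` may have infinite intensity, but it contributes nothing to either side.
  set r := f.range.erase 0 with hr
  have hr0 : ∀ c ∈ r, Λ (f ⁻¹' {c}) ≠ ∞ := fun c hc =>
    (SimpleFunc.integrable_iff.1 hf c (Finset.ne_of_mem_erase hc)).ne
  have hfm : ∀ c, MeasurableSet (f ⁻¹' {c}) := fun c => f.measurableSet_preimage _
  have h1 := hx.integral_exp_neg_sum (B := fun i => f ⁻¹' {(r.equivFin.symm i : ℝ)})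
    (fun i => hfm _) (fun i => hr0 _ (r.equivFin.symm i).2)
    (fun i j hij => by
      refine Disjoint.preimage _ (Set.disjoint_singleton.2 fun h => hij ?_)
      exact r.equivFin.symm.injective (Subtype.ext h))
    (fun i => (r.equivFin.symm i : ℝ))
  have hsum : ∀ F : ℝ → ℝ, ∑ i, F (r.equivFin.symm i : ℝ) = ∑ c ∈ r, F c := fun F => by
    rw [Equiv.sum_comp r.equivFin.symm (fun c : r => F c), Finset.sum_coe_sort r F]
  rw [hsum fun c => (1 - Real.exp (-c)) * Λ.real (f ⁻¹' {c})] at h1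
  have h2 : ∀ᵐ ω ∂μ, ∑' k, f (x k ω) =
      ∑ i, (r.equivFin.symm i : ℝ) * ({k | x k ω ∈ f ⁻¹' {(r.equivFin.symm i : ℝ)}}.ncard : ℝ) := by
    have h3 : ∀ᵐ ω ∂μ, ∀ c : r, {k | x k ω ∈ f ⁻¹' {(c : ℝ)}}.Finite :=
      ae_all_iff.2 fun c => hx.ae_finite (hfm _) (hr0 c c.2)
    filter_upwards [h3] with ω hω
    rw [hsum fun c => c * ({k | x k ω ∈ f ⁻¹' {c}}.ncard : ℝ)]
    have h4 : ∀ k, f (x k ω) = ∑ c ∈ r, {k | x k ω ∈ f ⁻¹' {c}}.indicator (fun _ => c) k := by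
      intro k
      have : ∀ c, {k | x k ω ∈ f ⁻¹' {c}}.indicator (fun _ => c) k =
          if f (x k ω) = c then c else 0 := fun c => by simp [Set.indicator]
      simp only [this, Finset.sum_ite_eq]
      split_ifs with h
      · rfl
      · by_contra h0
        exact h (Finset.mem_erase.2 ⟨h0, f.mem_range_self _⟩)
    simp only [h4]
    rw [Summable.tsum_finsetSum fun c hc => summable_of_hasFiniteSupport
      ((hω ⟨c, hc⟩).subset Set.support_indicator_subset)]
    refine Finset.sum_congr rfl fun c hc => ?_
    rw [← tsum_subtype, tsum_const, Nat.card_coe_set_eq, nsmul_eq_mul, mul_comm]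
  rw [integral_congr_ae (g := fun ω => Real.exp (-∑ i, (r.equivFin.symm i : ℝ) *
    ({k | x k ω ∈ f ⁻¹' {(r.equivFin.symm i : ℝ)}}.ncard : ℝ)))
    (h2.mono fun ω hω => by simp only [hω]), h1]
  congr 2
  have h5 := f.map_integral (fun c => 1 - Real.exp (-c)) hf (by simp)
  rw [SimpleFunc.integral_eq_integral _
    (SimpleFunc.integrable_iff.2 fun y hy => ?_)] at h5
  · simp only [SimpleFunc.coe_map, Function.comp_apply, smul_eq_mul] at h5
    rw [h5, hr]
    rw [← Finset.sum_erase (a := (0 : ℝ)) f.range (by simp)]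
    exact Finset.sum_congr rfl fun c _ => mul_comm _ _
  · refine (measure_mono ?_).trans_lt ((measure_biUnion_finset_le r fun c => f ⁻¹' {c}).trans_lt
      (ENNReal.sum_lt_top.2 fun c hc => (hr0 c hc).lt_top))
    intro z hz
    refine Set.mem_biUnion (x := f z) (Finset.mem_erase.2 ⟨fun h0 => hy ?_, f.mem_range_self z⟩) rfl
    rw [← show (f.map fun c => 1 - Real.exp (-c)) z = y from hz]
    simp [h0]

/-- The Laplace functional of a Poisson process. -/
theorem integral_exp_neg_tsum (hx : IsPoissonProcess μ Λ x) [IsProbabilityMeasure μ] [SigmaFinite Λ]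
    {g : E → ℝ} (hg : Measurable g) (hg0 : ∀ y, 0 ≤ g y) (hgi : Integrable g Λ) :
    ∫ ω, Real.exp (-∑' k, g (x k ω)) ∂μ = Real.exp (-∫ y, (1 - Real.exp (-g y)) ∂Λ) := by
  have h0 : (0 : ℝ) ∈ Set.Ici (0 : ℝ) := Set.self_mem_Ici
  set f := SimpleFunc.approxOn g hg (Set.Ici 0) 0 h0 with hf
  have hfn : ∀ n y, 0 ≤ f n y := fun n y => SimpleFunc.approxOn_mem hg h0 n y
  have hfb : ∀ n y, ‖f n y‖ ≤ g y + g y := fun n y => by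
    have := SimpleFunc.norm_approxOn_zero_le hg h0 y n
    rwa [Real.norm_of_nonneg (hg0 y)] at this
  have hfi : ∀ n, Integrable (f n) Λ := fun n =>
    SimpleFunc.integrable_approxOn hg hgi h0 (integrable_zero _ _ _) n
  have hft : ∀ y, Tendsto (fun n => f n y) atTop (𝓝 (g y)) := fun y =>
    SimpleFunc.tendsto_approxOn hg h0 (subset_closure (hg0 y))
  have hxm := hx.measurable
  -- Two dominated convergences: `2g`, almost surely summable along the points, dominates the sums,
  -- and `1` dominates the expectations.
  have hL : Tendsto (fun n => ∫ ω, Real.exp (-∑' k, f n (x k ω)) ∂μ) atTop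
      (𝓝 (∫ ω, Real.exp (-∑' k, g (x k ω)) ∂μ)) := by
    refine tendsto_integral_of_dominated_convergence (fun _ => 1) (fun n => ?_)
      (integrable_const _) (fun n => ae_of_all _ fun ω => ?_) ?_
    · have := fun k => (f n).measurable.comp (hxm k)
      exact (Real.measurable_exp.comp (Measurable.tsum this).neg).aestronglyMeasurable
    · rw [Real.norm_of_nonneg (Real.exp_pos _).le, Real.exp_le_one_iff, neg_nonpos]
      exact tsum_nonneg fun k => hfn n _
    · filter_upwards [hx.ae_summable hg hgi] with ω hω
      refine (Real.continuous_exp.tendsto _).comp (Tendsto.neg ?_)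
      exact tendsto_tsum_of_dominated_convergence (hω.add hω) (fun k => hft _)
        (Eventually.of_forall fun n k => hfb n _)
  have hR : Tendsto (fun n => Real.exp (-∫ y, (1 - Real.exp (-f n y)) ∂Λ)) atTop
      (𝓝 (Real.exp (-∫ y, (1 - Real.exp (-g y)) ∂Λ))) := by
    refine (Real.continuous_exp.tendsto _).comp (Tendsto.neg ?_)
    refine tendsto_integral_of_dominated_convergence (fun y => g y + g y) (fun n => ?_)
      (hgi.add hgi) (fun n => ae_of_all _ fun y => ?_) (ae_of_all _ fun y => ?_)
    · have := (f n).measurable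
      exact (by fun_prop : Measurable fun y => 1 - Real.exp (-f n y)).aestronglyMeasurable
    · have h1 : Real.exp (-f n y) ≤ 1 := by simpa using hfn n y
      have h2 := Real.add_one_le_exp (-f n y)
      rw [Real.norm_of_nonneg (by linarith)]
      have h3 := (le_abs_self _).trans (hfb n y)
      linarith
    · exact ((Real.continuous_exp.tendsto _).comp (hft y).neg).const_sub 1
  refine tendsto_nhds_unique hL (hR.congr fun n => ?_)
  exact (hx.integral_exp_neg_tsum_simpleFunc (f n) (hfi n)).symm

end IsPoissonProcess

/-! ### The complex Gaussian law -/

theorem measurable_complex_mk : Measurable fun p : ℝ × ℝ => (⟨p.1, p.2⟩ : ℂ) :=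
  Complex.measurableEquivRealProd.symm.measurable

instance (v : ℝ≥0) : IsProbabilityMeasure (complexGaussian v) :=
  Measure.isProbabilityMeasure_map measurable_complex_mk.aemeasurable

theorem charFun_complexGaussian (v : ℝ≥0) (t : ℂ) :
    charFun (complexGaussian v) t = Complex.exp (-(v * ‖t‖ ^ 2 / 4 : ℝ)) := by
  rw [charFun_apply, complexGaussian, integral_map measurable_complex_mk.aemeasurable
    (by fun_prop)]
  have h1 : ∀ p : ℝ × ℝ, Complex.exp (((inner ℝ (⟨p.1, p.2⟩ : ℂ) t : ℝ) : ℂ) * Complex.I) =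
      Complex.exp (((inner ℝ p.1 t.re : ℝ) : ℂ) * Complex.I) *
        Complex.exp (((inner ℝ p.2 t.im : ℝ) : ℂ) * Complex.I) := by
    intro p
    rw [← Complex.exp_add, ← add_mul, ← Complex.ofReal_add]
    congr 3
    simp [Complex.inner]
  simp only [h1]
  rw [integral_prod_mul (fun x : ℝ => Complex.exp (((inner ℝ x t.re : ℝ) : ℂ) * Complex.I))
    (fun x : ℝ => Complex.exp (((inner ℝ x t.im : ℝ) : ℂ) * Complex.I)),
    ← charFun_apply, ← charFun_apply, charFun_gaussianReal, charFun_gaussianReal,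
    ← Complex.exp_add, Complex.sq_norm, Complex.normSq_apply]
  congr 1
  push_cast
  ring

/-- The characteristic function depends only on `‖t‖`, so the phase of `a` drops out. For `‖a‖ = 1`
this is the rotation invariance that the detector analysis rests on. -/
theorem complexGaussian_map_mul (v : ℝ≥0) (a : ℂ) :
    (complexGaussian v).map (fun w => a * w) = complexGaussian (‖a‖₊ ^ 2 * v) := by
  have := Measure.isProbabilityMeasure_map (μ := complexGaussian v) (f := fun w => a * w)
    (by fun_prop)
  refine Measure.ext_of_charFun (funext fun t => ?_)
  rw [charFun_apply, integral_map (by fun_prop) (by fun_prop)]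
  have h1 : ∀ w : ℂ, inner ℝ (a * w) t = inner ℝ w ((starRingEnd ℂ) a * t) := by
    intro w
    simp [Complex.inner]
    ring
  simp only [h1]
  rw [← charFun_apply, charFun_complexGaussian, charFun_complexGaussian, norm_mul,
    RCLike.norm_conj]
  congr 1
  push_cast
  ring

theorem complexGaussian_reProd (v : ℝ≥0) {S T : Set ℝ} (hS : MeasurableSet S)
    (hT : MeasurableSet T) :
    (complexGaussian v).real {w | w.re ∈ S ∧ w.im ∈ T} =
      (gaussianReal 0 (v / 2)).real S * (gaussianReal 0 (v / 2)).real T := by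
  have hm : MeasurableSet {w : ℂ | w.re ∈ S ∧ w.im ∈ T} :=
    (Complex.measurable_re hS).inter (Complex.measurable_im hT)
  rw [← measureReal_prod_prod, complexGaussian, map_measureReal_apply measurable_complex_mk hm]
  rfl

/-- Integrals of radial functions with respect to the standard complex Gaussian law. -/
theorem integral_norm_complexGaussian_one {f : ℝ → ℝ} (hf : Measurable f) :
    ∫ w, f ‖w‖ ∂complexGaussian 1 = ∫ r in Set.Ioi (0 : ℝ), 2 * r * Real.exp (-r ^ 2) * f r := by
  have hv : (1 / 2 : ℝ≥0) ≠ 0 := by norm_num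
  have hfm : Measurable fun w : ℂ => f ‖w‖ := hf.comp measurable_norm
  have hpm : Measurable fun p : ℝ × ℝ => gaussianPDF 0 (1 / 2) p.1 * gaussianPDF 0 (1 / 2) p.2 :=
    ((measurable_gaussianPDF _ _).comp measurable_fst).mul
      ((measurable_gaussianPDF _ _).comp measurable_snd)
  rw [complexGaussian, integral_map measurable_complex_mk.aemeasurable
    hfm.aestronglyMeasurable, gaussianReal_of_var_ne_zero _ hv,
    prod_withDensity (measurable_gaussianPDF _ _) (measurable_gaussianPDF _ _),
    integral_withDensity_eq_integral_toReal_smul hpm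
      (ae_of_all _ fun p => ENNReal.mul_lt_top gaussianPDF_lt_top gaussianPDF_lt_top)]
  have h1 := Complex.volume_preserving_equiv_real_prod.symm.integral_comp
    Complex.measurableEquivRealProd.symm.measurableEmbedding
    (fun w : ℂ => Real.pi⁻¹ * Real.exp (-‖w‖ ^ 2) * f ‖w‖)
  have h2 : ∀ p : ℝ × ℝ, (gaussianPDF 0 (1 / 2) p.1 * gaussianPDF 0 (1 / 2) p.2).toReal •
      f ‖(⟨p.1, p.2⟩ : ℂ)‖ = Real.pi⁻¹ * Real.exp (-‖Complex.measurableEquivRealProd.symm p‖ ^ 2) *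
        f ‖Complex.measurableEquivRealProd.symm p‖ := by
    intro p
    have h3 : Complex.measurableEquivRealProd.symm p = (⟨p.1, p.2⟩ : ℂ) := rfl
    rw [h3, smul_eq_mul, ENNReal.toReal_mul, toReal_gaussianPDF, toReal_gaussianPDF,
      Complex.sq_norm, Complex.normSq_mk]
    congr 1
    simp only [gaussianPDFReal]
    push_cast
    rw [show 2 * Real.pi * (1 / 2) = Real.pi by ring,
      show ∀ a b c : ℝ, a * b * (a * c) = (a * a) * (b * c) by intros; ring, ← Real.exp_add,
      ← mul_inv, Real.mul_self_sqrt Real.pi_pos.le]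
    congr 2
    ring
  simp only [h2]
  rw [← Measure.volume_eq_prod]
  refine h1.trans ?_
  rw [integral_norm_complex fun r => Real.pi⁻¹ * Real.exp (-r ^ 2) * f r, ← integral_const_mul]
  refine integral_congr_ae (ae_of_all _ fun r => ?_)
  simp only
  field_simp

theorem integral_Ioi_mul_exp_neg_mul_sq {a b : ℝ} (ha : 0 ≤ a) (hb : 0 < b) :
    ∫ r in Set.Ioi a, 2 * r * Real.exp (-(b * r ^ 2)) = Real.exp (-(b * a ^ 2)) / b := by
  have hd : ∀ r ∈ Set.Ici a, HasDerivAt (fun r => -(Real.exp (-(b * r ^ 2)) / b))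
      (2 * r * Real.exp (-(b * r ^ 2))) r := by
    intro r _
    have := ((((hasDerivAt_pow 2 r).const_mul b).neg.exp).div_const b).neg
    refine this.congr_deriv ?_
    field_simp
    norm_num
    ring
  have ht : Tendsto (fun r => -(Real.exp (-(b * r ^ 2)) / b)) atTop (𝓝 (-(0 / b))) := by
    refine ((Real.tendsto_exp_atBot.comp ?_).div_const b).neg
    exact tendsto_neg_atTop_atBot.comp ((tendsto_pow_atTop two_ne_zero).const_mul_atTop hb)
  have h := integral_Ioi_of_hasDerivAt_of_nonneg' hd
    (fun r hr => by have : 0 ≤ r := ha.trans (le_of_lt hr); positivity) ht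
  rw [h]
  simp

/-- The squared modulus of a standard complex Gaussian variable is exponentially distributed. -/
theorem complexGaussian_one_tail {t : ℝ} (ht : 0 ≤ t) :
    (complexGaussian 1).real {w | t < ‖w‖ ^ 2} = Real.exp (-t) := by
  have hm : MeasurableSet {r : ℝ | t < r ^ 2} := measurableSet_lt measurable_const (by fun_prop)
  have h := integral_norm_complexGaussian_one
    (f := {r : ℝ | t < r ^ 2}.indicator fun _ => 1) (measurable_const.indicator hm)
  have h1 : ∫ w, ({r : ℝ | t < r ^ 2}.indicator (fun _ => (1 : ℝ)) ‖w‖) ∂complexGaussian 1 =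
      (complexGaussian 1).real {w | t < ‖w‖ ^ 2} :=
    integral_indicator_one (μ := complexGaussian 1) (s := {w : ℂ | t < ‖w‖ ^ 2})
      (measurable_norm hm)
  have h2 : ∫ r in Set.Ioi (0 : ℝ), 2 * r * Real.exp (-r ^ 2) *
      {r : ℝ | t < r ^ 2}.indicator (fun _ => 1) r =
      ∫ r in Set.Ioi (0 : ℝ), (Set.Ioi √t).indicator
        (fun r => 2 * r * Real.exp (-(1 * r ^ 2))) r := by
    refine setIntegral_congr_fun measurableSet_Ioi fun r hr => ?_
    have : t < r ^ 2 ↔ √t < r := (Real.sqrt_lt' hr).symm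
    by_cases h : √t < r <;> simp [Set.indicator, this, h]
  rw [← h1, h, h2, setIntegral_indicator measurableSet_Ioi, Set.inter_eq_self_of_subset_right
    (Set.Ioi_subset_Ioi (Real.sqrt_nonneg t)),
    integral_Ioi_mul_exp_neg_mul_sq (Real.sqrt_nonneg t) one_pos, Real.sq_sqrt ht]
  simp

/-- The Laplace transform of the exponential law of `‖w‖²`: each interferer will contribute one such
factor. -/
theorem integral_exp_neg_mul_sq_complexGaussian_one {t : ℝ} (ht : 0 ≤ t) :
    ∫ w, Real.exp (-(t * ‖w‖ ^ 2)) ∂complexGaussian 1 = (1 + t)⁻¹ := by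
  rw [integral_norm_complexGaussian_one (f := fun r => Real.exp (-(t * r ^ 2))) (by fun_prop)]
  have h := integral_Ioi_mul_exp_neg_mul_sq le_rfl (by linarith : 0 < 1 + t)
  simp only [ne_eq, OfNat.ofNat_ne_zero, not_false_eq_true, zero_pow, mul_zero, neg_zero,
    Real.exp_zero, one_div] at h
  rw [← h]
  refine integral_congr_ae (ae_of_all _ fun r => ?_)
  simp only
  rw [mul_assoc, ← Real.exp_add]
  congr 2
  ring

theorem integrable_id_complexGaussian (v : ℝ≥0) :
    Integrable (fun w : ℂ => w) (complexGaussian v) := by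
  rw [complexGaussian, integrable_map_measure (by fun_prop) measurable_complex_mk.aemeasurable]
  have h : Integrable (fun x : ℝ => x) (gaussianReal 0 (v / 2)) :=
    memLp_one_iff_integrable.1 (by exact_mod_cast memLp_id_gaussianReal (μ := 0) (v := v / 2) 1)
  have h1 : Integrable (fun p : ℝ × ℝ => p.1) ((gaussianReal 0 (v / 2)).prod
    (gaussianReal 0 (v / 2))) := h.comp_fst _
  have h2 : Integrable (fun p : ℝ × ℝ => p.2) ((gaussianReal 0 (v / 2)).prod
    (gaussianReal 0 (v / 2))) := h.comp_snd _
  refine (h1.ofReal (𝕜 := ℂ)).add ((h2.ofReal (𝕜 := ℂ)).mul_const Complex.I) |>.congr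
    (ae_of_all _ fun p => ?_)
  simp [Complex.ext_iff]

/-- The law is invariant under `w ↦ -w`, so its mean equals its own negative. -/
theorem integral_id_complexGaussian (v : ℝ≥0) : ∫ w, w ∂complexGaussian v = 0 := by
  have h := complexGaussian_map_mul v (-1)
  have h2 := integral_map (μ := complexGaussian v) (φ := fun w => -1 * w) (f := fun w : ℂ => w)
    (by fun_prop) (by fun_prop)
  rw [h] at h2
  simp only [nnnorm_neg, nnnorm_one, one_pow, one_mul, neg_mul] at h2
  rw [integral_neg] at h2
  exact self_eq_neg.1 h2

theorem complexGaussian_singleton_zero : complexGaussian 1 {0} = 0 := by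
  have h := complexGaussian_one_tail le_rfl
  simp only [neg_zero, Real.exp_zero] at h
  have h1 : {w : ℂ | 0 < ‖w‖ ^ 2} = {0}ᶜ := by
    ext w; simp [sq_pos_iff]
  rw [h1, probReal_compl_eq_one_sub (measurableSet_singleton _)] at h
  exact (measureReal_eq_zero_iff).1 (by linarith)

/-- The law `N(0, v)` of the set cut out by a lower bound `-√(2v) ρ` (if `p`) and an upper bound
`√(2v) ρ` (if `q`). -/
theorem gaussianReal_interval {v : ℝ≥0} (hv : v ≠ 0) {ρ : ℝ} (hρ : 0 < ρ) (p q : Prop)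
    [Decidable p] [Decidable q] :
    (gaussianReal 0 v).real {x | (p → -(√(2 * v) * ρ) < x) ∧ (q → x < √(2 * v) * ρ)} =
      1 - ((if p then 1 else 0) + (if q then 1 else 0)) * (erfc ρ / 2) := by
  have hv' : (0 : ℝ) < v := by positivity
  set a := √(2 * v : ℝ) * ρ with ha
  have ha0 : 0 < a := by positivity
  have hatom : NullSingletonClass (gaussianReal 0 v) := nullSingletonClass_gaussianReal hv
  have h1 : (gaussianReal 0 v).real (Set.Ici a) = erfc ρ / 2 := by
    rw [← gaussianReal_Ioi hv, measureReal_def, measureReal_def, Ioi_ae_eq_Ici.measure_eq]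
  have h2 : (gaussianReal 0 v).real (Set.Iic (-a)) = erfc ρ / 2 := by
    rw [← h1]
    have := gaussianReal_map_neg (μ := 0) (v := v)
    rw [neg_zero] at this
    conv_rhs => rw [← this]
    rw [map_measureReal_apply (by fun_prop) measurableSet_Ici]
    congr 1
    ext x
    simp [le_neg]
  -- The complement is a union of at most two disjoint tails, each of mass `erfc ρ / 2`.
  have hset : {x | (p → -a < x) ∧ (q → x < a)} =
      ((if p then Set.Iic (-a) else ∅) ∪ (if q then Set.Ici a else ∅))ᶜ := by
    ext x
    by_cases hp : p <;> by_cases hq : q <;> simp [hp, hq]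
  have hd : Disjoint (if p then Set.Iic (-a) else ∅) (if q then Set.Ici a else ∅) := by
    have : Disjoint (Set.Iic (-a)) (Set.Ici a) := Set.disjoint_left.2 fun x hx hx' => by
      have h3 : x ≤ -a := hx
      have h4 : a ≤ x := hx'
      linarith
    by_cases hp : p <;> by_cases hq : q <;> simp [hp, hq, this]
  have hm1 : MeasurableSet (if p then Set.Iic (-a) else ∅) := by
    split_ifs <;> simp [measurableSet_Iic]
  have hm2 : MeasurableSet (if q then Set.Ici a else ∅) := by
    split_ifs <;> simp [measurableSet_Ici]
  rw [hset, probReal_compl_eq_one_sub (hm1.union hm2), measureReal_union hd hm2]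
  by_cases hp : p <;> by_cases hq : q <;> simp [hp, hq, h1, h2]
  ring

/-! ### Random series with Gaussian coefficients -/

section RandomSeries

variable {Ω : Type*} [MeasurableSpace Ω] {μ : Measure Ω} [IsProbabilityMeasure μ]

/-- A series of independent centred random variables with partial sums bounded in `L¹` converges
almost surely. -/
theorem ae_exists_tendsto_sum_of_iIndepFun {Y : ℕ → Ω → ℝ} (hY : ∀ k, Measurable (Y k))
    (hYi : ∀ k, Integrable (Y k) μ) (hind : iIndepFun Y μ) (hmean : ∀ k, ∫ ω, Y k ω ∂μ = 0)
    {R : ℝ≥0} (hR : ∀ K, eLpNorm (fun ω => ∑ k ∈ Finset.range K, Y k ω) 1 μ ≤ R) :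
    ∀ᵐ ω ∂μ, ∃ l, Tendsto (fun K => ∑ k ∈ Finset.range K, Y k ω) atTop (𝓝 l) := by
  set F := Filtration.natural Y fun k => (hY k).stronglyMeasurable with hF
  have hYF : ∀ {i k : ℕ}, k ≤ i → StronglyMeasurable[F i] (Y k) := fun {i k} hki =>
    (Filtration.stronglyAdapted_natural fun k => (hY k).stronglyMeasurable).stronglyMeasurable_le hki
  -- The sum at time `i` runs through `Y i`, matching the natural filtration; the shift is undone
  -- when the limit is returned.
  set S : ℕ → Ω → ℝ := fun i ω => ∑ k ∈ Finset.range (i + 1), Y k ω with hS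
  have hSi : ∀ i, Integrable (S i) μ := fun i => integrable_finsetSum _ fun k _ => hYi k
  have hSm : ∀ i, StronglyMeasurable[F i] (S i) := fun i =>
    Finset.stronglyMeasurable_fun_sum _ fun k hk =>
      hYF (Nat.lt_succ_iff.1 (Finset.mem_range.1 hk))
  have hM : Martingale S F μ := by
    refine martingale_nat hSm hSi fun i => ?_
    have h1 : S (i + 1) = S i + Y (i + 1) := by
      ext ω; simp [hS, Finset.sum_range_succ _ (i + 1)]
    rw [h1]
    have h2 := condExp_add (hSi i) (hYi (i + 1)) (F i)
    have h3 := hind.condExp_natural_ae_eq_of_lt (fun k => (hY k).stronglyMeasurable)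
      (Nat.lt_succ_self i)
    rw [condExp_of_stronglyMeasurable (F.le i) (hSm i) (hSi i)] at h2
    filter_upwards [h2, h3] with ω h2 h3
    rw [h2, Pi.add_apply]
    rw [← hF] at h3
    rw [show i + 1 = i.succ from rfl, h3, hmean, add_zero]
  filter_upwards [hM.submartingale.exists_ae_tendsto_of_bdd (R := R) fun i => hR (i + 1)]
    with ω ⟨l, hl⟩
  exact ⟨l, (tendsto_add_atTop_iff_nat 1).1 hl⟩

variable {s : ℕ → Ω → ℂ} {n : Ω → ℂ} {N₀ : ℝ≥0} {a : ℕ → ℂ}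

theorem hasLaw_sum_mul (hs : ∀ k, HasLaw (s k) (complexGaussian 1) μ) (hi : iIndepFun s μ)
    (K : ℕ) : HasLaw (fun ω => ∑ k ∈ Finset.range K, a k * s k ω)
      (complexGaussian (∑ k ∈ Finset.range K, ‖a k‖₊ ^ 2)) μ := by
  have hm : ∀ k, AEMeasurable (fun ω => a k * s k ω) μ := fun k =>
    (hs k).aemeasurable.const_mul (a k)
  have hsum : AEMeasurable (fun ω => ∑ k ∈ Finset.range K, a k * s k ω) μ :=
    Finset.aemeasurable_fun_sum _ fun k _ => hm k
  refine ⟨hsum, ?_⟩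
  have := Measure.isProbabilityMeasure_map hsum
  refine Measure.ext_of_charFun (funext fun t => ?_)
  have h0 : iIndepFun (fun k ω => a k * s k ω) μ :=
    hi.comp (fun k w => a k * w) fun k => by fun_prop
  have h1 : iIndepFun ((Finset.range K).restrict fun k ω => a k * s k ω) μ :=
    h0.precomp (g := ((↑) : Finset.range K → ℕ)) Subtype.val_injective
  have h2 := congrFun (h1.charFun_map_fun_finsetSum_eq_prod fun k _ => hm k) t
  refine h2.trans ?_
  have h3 : ∀ k, charFun (μ.map (fun ω => a k * s k ω)) t =
      Complex.exp (-(‖a k‖ ^ 2 * ‖t‖ ^ 2 / 4 : ℝ)) := by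
    intro k
    have h4 := AEMeasurable.map_map_of_aemeasurable (g := fun w => a k * w) (by fun_prop)
      (hs k).aemeasurable
    rw [(hs k).map_eq, complexGaussian_map_mul] at h4
    refine (congrFun (congrArg charFun h4.symm) t).trans ?_
    rw [ charFun_complexGaussian]
    simp
  rw [Finset.prod_apply, Finset.prod_congr rfl fun k _ => h3 k, ← Complex.exp_sum,
    charFun_complexGaussian]
  congr 1
  push_cast
  rw [Finset.sum_neg_distrib, Finset.sum_mul, Finset.sum_div]

theorem ae_exists_tendsto_sum_mul (hsm : ∀ k, Measurable (s k))
    (hs : ∀ k, HasLaw (s k) (complexGaussian 1) μ) (hi : iIndepFun s μ)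
    (ha : Summable fun k => ‖a k‖₊ ^ 2) :
    ∀ᵐ ω ∂μ, ∃ l, Tendsto (fun K => ∑ k ∈ Finset.range K, a k * s k ω) atTop (𝓝 l) := by
  set C := eLpNorm (fun w : ℂ => w) 1 (complexGaussian 1) with hC
  have hCt : C ≠ ∞ := (memLp_one_iff_integrable.2 (integrable_id_complexGaussian 1)).2.ne
  have hsi : ∀ k, Integrable (s k) μ := fun k => by
    have := integrable_id_complexGaussian 1
    rw [← (hs k).map_eq] at this
    exact this.comp_aemeasurable (hs k).aemeasurable
  have hbound : ∀ K, eLpNorm (fun ω => ∑ k ∈ Finset.range K, a k * s k ω) 1 μ ≤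
      ((NNReal.sqrt (∑' k, ‖a k‖₊ ^ 2) * C.toNNReal : ℝ≥0) : ℝ≥0∞) := by
    intro K
    set V := ∑ k ∈ Finset.range K, ‖a k‖₊ ^ 2 with hV
    have h1 := hasLaw_sum_mul (a := a) hs hi K
    have h2 := eLpNorm_map_measure (μ := μ) (p := 1) (g := fun w : ℂ => w)
      (by fun_prop) h1.aemeasurable
    have h3 : eLpNorm (fun w : ℂ => w) 1 (complexGaussian V) = NNReal.sqrt V * C := by
      -- `CN(0, V)` is the law of `√V` times a `CN(0, 1)` variable, so its `L¹` norm is `√V * C`.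
      have h4 := complexGaussian_map_mul 1 ((NNReal.sqrt V : ℝ) : ℂ)
      rw [show ‖((NNReal.sqrt V : ℝ) : ℂ)‖₊ = NNReal.sqrt V by ext; simp, NNReal.sq_sqrt,
        mul_one] at h4
      rw [← h4, eLpNorm_map_measure (by fun_prop) (by fun_prop)]
      have h5 := eLpNorm_const_smul ((NNReal.sqrt V : ℝ) : ℂ) (fun w : ℂ => w) 1 (complexGaussian 1)
      refine h5.trans ?_
      rw [← hC, enorm_eq_nnnorm]
      congr 2
      ext
      simp
    rw [h1.map_eq, h3] at h2
    refine h2.symm.le.trans ?_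
    rw [ENNReal.coe_mul, ENNReal.coe_toNNReal hCt]
    gcongr
    exact ha.sum_le_tsum _ fun _ _ => zero_le
  have key : ∀ L : ℂ →L[ℝ] ℝ, ‖L‖ ≤ 1 →
      ∀ᵐ ω ∂μ, ∃ l, Tendsto (fun K => L (∑ k ∈ Finset.range K, a k * s k ω)) atTop (𝓝 l) := by
    intro L hL
    have hLi : ∀ k, Integrable (fun ω => L (a k * s k ω)) μ := fun k =>
      L.integrable_comp ((hsi k).const_mul (a k))
    have h := ae_exists_tendsto_sum_of_iIndepFun (Y := fun k ω => L (a k * s k ω))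
      (fun k => by have := hsm k; fun_prop) hLi
      (hi.comp (fun k w => L (a k * w)) fun k => by fun_prop)
      (fun k => ?_) (R := NNReal.sqrt (∑' k, ‖a k‖₊ ^ 2) * C.toNNReal) fun K => ?_
    · simpa only [map_sum] using h
    · rw [L.integral_comp_comm ((hsi k).const_mul (a k)), integral_const_mul]
      have h0 : ∫ ω, s k ω ∂μ = 0 := by
        rw [← integral_id_complexGaussian 1]
        exact (hs k).integral_comp (f := fun w => w) (by fun_prop)
      simp [h0]
    · refine le_trans (eLpNorm_mono fun ω => ?_) (hbound K)
      rw [← map_sum]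
      exact (L.le_of_opNorm_le hL _).trans_eq (one_mul _)
  filter_upwards [key Complex.reCLM Complex.reCLM_norm.le, key Complex.imCLM Complex.imCLM_norm.le]
    with ω ⟨l₁, h₁⟩ ⟨l₂, h₂⟩
  refine ⟨⟨l₁, l₂⟩, ?_⟩
  have h := ((Complex.continuous_ofReal.tendsto l₁).comp h₁).add
    (((Complex.continuous_ofReal.tendsto l₂).comp h₂).mul_const Complex.I)
  rw [show (⟨l₁, l₂⟩ : ℂ) = l₁ + l₂ * Complex.I by simp [Complex.ext_iff]]
  exact h.congr fun K => Complex.re_add_im _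

/-- The law of a square-summable Gaussian series plus an independent Gaussian variable. -/
theorem hasLaw_limUnder_add (hsm : ∀ k, Measurable (s k))
    (hs : ∀ k, HasLaw (s k) (complexGaussian 1) μ) (hi : iIndepFun s μ)
    (hn : HasLaw n (complexGaussian N₀) μ) (hsn : IndepFun (fun ω k => s k ω) n μ)
    (ha : Summable fun k => ‖a k‖₊ ^ 2) :
    HasLaw (fun ω => limUnder atTop (fun K => ∑ k ∈ Finset.range K, a k * s k ω) + n ω)
      (complexGaussian (∑' k, ‖a k‖₊ ^ 2 + N₀)) μ := by
  -- The limit is a measurable function of the whole coefficient sequence (also where it takes a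
  -- default value), which is what transfers independence from `n` to it.
  set A : (ℕ → ℂ) → ℂ := fun w => limUnder atTop fun K => ∑ k ∈ Finset.range K, a k * w k with hA
  have hAm : Measurable A := (StronglyMeasurable.limUnder fun K =>
    (by fun_prop : Measurable fun w : ℕ → ℂ => ∑ k ∈ Finset.range K, a k * w k).stronglyMeasurable
    ).measurable
  have hsm' : Measurable fun ω k => s k ω := measurable_pi_lambda _ hsm
  have hAs : Measurable fun ω => A fun k => s k ω := hAm.comp hsm'
  have hlaw : charFun (μ.map fun ω => A fun k => s k ω) =
      charFun (complexGaussian (∑' k, ‖a k‖₊ ^ 2)) := by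
    funext t
    have h1 : Tendsto (fun K => charFun (complexGaussian (∑ k ∈ Finset.range K, ‖a k‖₊ ^ 2)) t)
        atTop (𝓝 (charFun (complexGaussian (∑' k, ‖a k‖₊ ^ 2)) t)) := by
      have h2 := (NNReal.continuous_coe.tendsto _).comp ha.hasSum.tendsto_sum_nat
      simp only [charFun_complexGaussian]
      have h3 := ((h2.mul_const (‖t‖ ^ 2)).div_const 4)
      exact (Complex.continuous_exp.tendsto _).comp
        ((Complex.continuous_ofReal.tendsto _).comp h3).neg
    refine tendsto_nhds_unique (f := fun K =>
      charFun (complexGaussian (∑ k ∈ Finset.range K, ‖a k‖₊ ^ 2)) t) ?_ h1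
    have h4 : ∀ K, charFun (complexGaussian (∑ k ∈ Finset.range K, ‖a k‖₊ ^ 2)) t =
        ∫ ω, Complex.exp ((inner ℝ (∑ k ∈ Finset.range K, a k * s k ω) t : ℝ) * Complex.I) ∂μ := by
      intro K
      have h5 := hasLaw_sum_mul (a := a) hs hi K
      rw [← h5.map_eq, charFun_apply, integral_map h5.aemeasurable (by fun_prop)]
    simp only [h4]
    rw [charFun_apply, integral_map hAs.aemeasurable (by fun_prop)]
    refine tendsto_integral_of_dominated_convergence (fun _ => 1) (fun K => ?_)
      (integrable_const _) (fun K => ae_of_all _ fun ω => (Complex.norm_exp_ofReal_mul_I _).le) ?_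
    · have := hsm
      exact (by fun_prop : Measurable fun ω => Complex.exp
        ((inner ℝ (∑ k ∈ Finset.range K, a k * s k ω) t : ℝ) * Complex.I)).aestronglyMeasurable
    · filter_upwards [ae_exists_tendsto_sum_mul hsm hs hi ha] with ω hω
      have h6 := tendsto_nhds_limUnder hω
      have h7 : Continuous fun w : ℂ => Complex.exp ((inner ℝ w t : ℝ) * Complex.I) := by fun_prop
      exact (h7.tendsto _).comp h6
  have hmeas : AEMeasurable (fun ω => A (fun k => s k ω) + n ω) μ :=
    hAs.aemeasurable.add hn.aemeasurable
  refine ⟨hmeas, ?_⟩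
  have := Measure.isProbabilityMeasure_map hmeas
  refine Measure.ext_of_charFun ?_
  have hind : IndepFun (fun ω => A fun k => s k ω) n μ := hsn.comp hAm measurable_id
  refine (hind.charFun_map_fun_add_eq_mul hAs.aemeasurable hn.aemeasurable).trans ?_
  rw [hlaw, hn.map_eq]
  funext t
  rw [Pi.mul_apply, charFun_complexGaussian, charFun_complexGaussian, charFun_complexGaussian,
    ← Complex.exp_add]
  congr 1
  push_cast
  ring

end RandomSeries

/-! ### Independence and conditioning -/

section Independence

variable {Ω α β γ : Type*} [MeasurableSpace Ω] [MeasurableSpace α] [MeasurableSpace β]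
  [MeasurableSpace γ] {μ : Measure Ω} {X : Ω → α} {Y : Ω → β} {Z : Ω → γ}

/-- A block of coordinates generates the supremum of their σ-algebras, and suprema over disjoint
index sets are independent. -/
theorem indepFun_restrict_of_iIndepFun {ι : Type*} {m : ι → Ω → α} (hm : ∀ i, Measurable (m i))
    (h : iIndepFun m μ) {S T : Set ι} (hST : Disjoint S T) :
    IndepFun (fun ω (i : S) => m i ω) (fun ω (i : T) => m i ω) μ := by
  have h1 := indep_iSup_of_disjoint (fun i => (hm i).comap_le) h.iIndep hST
  have h2 : ∀ U : Set ι, MeasurableSpace.comap (fun ω (i : U) => m i ω) MeasurableSpace.pi =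
      ⨆ i ∈ U, MeasurableSpace.comap (m i) inferInstance := by
    intro U
    rw [MeasurableSpace.pi, MeasurableSpace.comap_iSup, iSup_subtype']
    simp only [MeasurableSpace.comap_comp]
    rfl
  rw [IndepFun_iff_Indep, h2, h2]
  exact h1

variable [IsProbabilityMeasure μ]

/-- Fubini for the product law, with the second variable resampled on a copy of `Ω`. This plays the
role of conditioning on `X`. -/
theorem integral_comp_of_indepFun (hX : Measurable X) (hY : Measurable Y) (h : IndepFun X Y μ)
    {f : α × β → ℝ} (hf : Measurable f) {C : ℝ} (hC : ∀ p, ‖f p‖ ≤ C) :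
    ∫ ω, f (X ω, Y ω) ∂μ = ∫ ω, ∫ ω', f (X ω, Y ω') ∂μ ∂μ := by
  have h1 := h.map_prod_eq_prod_map_map hX.aemeasurable hY.aemeasurable
  have := Measure.isProbabilityMeasure_map (μ := μ) hX.aemeasurable
  have := Measure.isProbabilityMeasure_map (μ := μ) hY.aemeasurable
  have hi : Integrable f ((μ.map X).prod (μ.map Y)) :=
    (integrable_const C).mono' hf.aestronglyMeasurable (ae_of_all _ hC)
  rw [← integral_map (hX.prodMk hY).aemeasurable hf.aestronglyMeasurable, h1, integral_prod f hi,
    integral_map hX.aemeasurable hi.integral_prod_left.aestronglyMeasurable]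
  refine integral_congr_ae (ae_of_all _ fun ω => ?_)
  exact integral_map hY.aemeasurable (hf.comp measurable_prodMk_left).aestronglyMeasurable

theorem measureReal_of_indepFun (hX : Measurable X) (hY : Measurable Y) (h : IndepFun X Y μ)
    {A : Set (α × β)} (hA : MeasurableSet A) :
    μ.real {ω | (X ω, Y ω) ∈ A} = ∫ ω, μ.real {ω' | (X ω, Y ω') ∈ A} ∂μ := by
  have h1 := integral_comp_of_indepFun hX hY h (f := A.indicator fun _ => 1)
    (measurable_const.indicator hA) (C := 1) fun p => by
      by_cases hp : p ∈ A <;> simp [hp]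
  have h2 : ∫ ω, A.indicator (fun _ => (1 : ℝ)) (X ω, Y ω) ∂μ = μ.real {ω | (X ω, Y ω) ∈ A} :=
    integral_indicator_one (s := {ω | (X ω, Y ω) ∈ A}) ((hX.prodMk hY) hA)
  rw [← h2, h1]
  refine integral_congr_ae (ae_of_all _ fun ω => ?_)
  exact integral_indicator_one (s := {ω' | (X ω, Y ω') ∈ A}) ((measurable_prodMk_left.comp hY) hA)

/-- The probability of the exceptional set is the integral of its sections, which are almost all
null. -/
theorem ae_of_indepFun (hX : Measurable X) (hY : Measurable Y) (h : IndepFun X Y μ)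
    {A : Set (α × β)} (hA : MeasurableSet A) (hae : ∀ᵐ ω ∂μ, ∀ᵐ ω' ∂μ, (X ω, Y ω') ∈ A) :
    ∀ᵐ ω ∂μ, (X ω, Y ω) ∈ A := by
  have h1 := measureReal_of_indepFun hX hY h hA.compl
  have h2 : ∀ᵐ ω ∂μ, μ.real {ω' | (X ω, Y ω') ∈ Aᶜ} = 0 := hae.mono fun ω hω =>
    (measureReal_eq_zero_iff (measure_ne_top _ _)).2 hω
  rw [integral_congr_ae h2, integral_zero] at h1
  exact (measureReal_eq_zero_iff).1 h1

/-- The joint law is `μ_X ⊗ (μ_Y ⊗ μ_Z)`; reassociating the product gives the claim. -/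
theorem indepFun_prodMk_of_indepFun (hX : Measurable X) (hY : Measurable Y) (hZ : Measurable Z)
    (h : IndepFun X (fun ω => (Y ω, Z ω)) μ) (hYZ : IndepFun Y Z μ) :
    IndepFun (fun ω => (X ω, Y ω)) Z μ := by
  have := Measure.isProbabilityMeasure_map (μ := μ) hX.aemeasurable
  have := Measure.isProbabilityMeasure_map (μ := μ) hY.aemeasurable
  have := Measure.isProbabilityMeasure_map (μ := μ) hZ.aemeasurable
  have h1 := h.map_prod_eq_prod_map_map hX.aemeasurable (hY.prodMk hZ).aemeasurable
  have h2 := hYZ.map_prod_eq_prod_map_map hY.aemeasurable hZ.aemeasurable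
  have h3 := (h.comp measurable_id measurable_fst : IndepFun X Y μ).map_prod_eq_prod_map_map
    hX.aemeasurable hY.aemeasurable
  rw [indepFun_iff_map_prod_eq_prod_map_map (hX.prodMk hY).aemeasurable hZ.aemeasurable, h3]
  refine MeasurableEquiv.prodAssoc.map_measurableEquiv_injective ?_
  rw [Measure.prodAssoc_prod, ← h2, ← h1, Measure.map_map MeasurableEquiv.prodAssoc.measurable
    ((hX.prodMk hY).prodMk hZ)]
  rfl

end Independence

/-! ### The independence structure of the network -/

namespace IsDownlinkNetwork

variable {Ω : Type*} [MeasurableSpace Ω] {μ : Measure Ω} {lam r₀ : ℝ} {N₀ : ℝ≥0}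
  {x : ℕ → Ω → EuclideanSpace ℝ (Fin 2)} {h s : ℕ → Ω → ℂ} {h₀ n : Ω → ℂ}

theorem measurable_marks (hnet : IsDownlinkNetwork μ lam r₀ N₀ x h s h₀ n)
    (i : (ℕ ⊕ ℕ) ⊕ Fin 2) : Measurable (Sum.elim (Sum.elim h s) ![h₀, n] i) := by
  rcases i with (i | i) | i
  · exact hnet.measurable_h i
  · exact hnet.measurable_s i
  · fin_cases i
    · exact hnet.measurable_h₀
    · exact hnet.measurable_n

theorem measurable_x (hnet : IsDownlinkNetwork μ lam r₀ N₀ x h s h₀ n) :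
    Measurable fun ω k => x k ω := measurable_pi_lambda _ hnet.points.measurable

theorem measurable_h_seq (hnet : IsDownlinkNetwork μ lam r₀ N₀ x h s h₀ n) :
    Measurable fun ω k => h k ω := measurable_pi_lambda _ hnet.measurable_h

theorem measurable_s_seq (hnet : IsDownlinkNetwork μ lam r₀ N₀ x h s h₀ n) :
    Measurable fun ω k => s k ω := measurable_pi_lambda _ hnet.measurable_s

theorem iIndepFun_h (hnet : IsDownlinkNetwork μ lam r₀ N₀ x h s h₀ n) : iIndepFun h μ :=
  hnet.indep_marks.precomp (g := fun k => Sum.inl (Sum.inl k))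
    (Sum.inl_injective.comp Sum.inl_injective)

theorem iIndepFun_s (hnet : IsDownlinkNetwork μ lam r₀ N₀ x h s h₀ n) : iIndepFun s μ :=
  hnet.indep_marks.precomp (g := fun k => Sum.inl (Sum.inr k))
    (Sum.inl_injective.comp Sum.inr_injective)

theorem indepFun_x_h (hnet : IsDownlinkNetwork μ lam r₀ N₀ x h s h₀ n) :
    IndepFun (fun ω k => x k ω) (fun ω k => h k ω) μ :=
  hnet.indep_points.comp (φ := id)
    (ψ := fun (w : (ℕ ⊕ ℕ) ⊕ Fin 2 → ℂ) (k : ℕ) => w (Sum.inl (Sum.inl k))) measurable_id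
    (by fun_prop)

theorem indepFun_s_n (hnet : IsDownlinkNetwork μ lam r₀ N₀ x h s h₀ n) :
    IndepFun (fun ω k => s k ω) n μ := by
  have h1 := indepFun_restrict_of_iIndepFun hnet.measurable_marks hnet.indep_marks
    (S := Set.range fun k => Sum.inl (Sum.inr k)) (T := {Sum.inr 1}) (by
      rw [Set.disjoint_singleton_right]; simp)
  have hψ : Measurable fun w : ({Sum.inr 1} : Set ((ℕ ⊕ ℕ) ⊕ Fin 2)) → ℂ => w ⟨Sum.inr 1, rfl⟩ :=
    measurable_pi_apply _
  exact h1.comp (φ := fun w k => w ⟨Sum.inl (Sum.inr k), k, rfl⟩) (by fun_prop) hψ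

variable [IsProbabilityMeasure μ]

theorem indepFun_points_marks (hnet : IsDownlinkNetwork μ lam r₀ N₀ x h s h₀ n)
    {S T : Set ((ℕ ⊕ ℕ) ⊕ Fin 2)} (hST : Disjoint S T) :
    IndepFun (fun ω => (fun k => x k ω, fun i : S => Sum.elim (Sum.elim h s) ![h₀, n] i ω))
      (fun ω (i : T) => Sum.elim (Sum.elim h s) ![h₀, n] i ω) μ := by
  have hm := hnet.measurable_marks
  refine indepFun_prodMk_of_indepFun hnet.measurable_x
    (measurable_pi_lambda _ fun i => hm i) (measurable_pi_lambda _ fun i => hm i) ?_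
    (indepFun_restrict_of_iIndepFun hm hnet.indep_marks hST)
  exact hnet.indep_points.comp (φ := id) (ψ := fun w => (fun i : S => w i, fun i : T => w i))
    measurable_id (by fun_prop)

theorem indepFun_xh_h₀ (hnet : IsDownlinkNetwork μ lam r₀ N₀ x h s h₀ n) :
    IndepFun (fun ω => (fun k => x k ω, fun k => h k ω)) h₀ μ := by
  have h1 := hnet.indepFun_points_marks
    (S := Set.range fun k => Sum.inl (Sum.inl k)) (T := {Sum.inr 0}) (by
      rw [Set.disjoint_singleton_right]; simp)
  have hψ : Measurable fun w : ({Sum.inr 0} : Set ((ℕ ⊕ ℕ) ⊕ Fin 2)) → ℂ => w ⟨Sum.inr 0, rfl⟩ :=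
    measurable_pi_apply _
  exact h1.comp (φ := fun w => (w.1, fun k => w.2 ⟨Sum.inl (Sum.inl k), k, rfl⟩)) (by fun_prop) hψ

/-- This separates everything that determines the SINR from the symbols and the noise, which stay
random when the detector is analysed. -/
theorem indepFun_xhh₀_sn (hnet : IsDownlinkNetwork μ lam r₀ N₀ x h s h₀ n) :
    IndepFun (fun ω => (((fun k => x k ω), (fun k => h k ω)), h₀ ω))
      (fun ω => ((fun k => s k ω), n ω)) μ := by
  have h1 := hnet.indepFun_points_marks
    (S := (Set.range fun k => Sum.inl (Sum.inl k)) ∪ {Sum.inr 0})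
    (T := (Set.range fun k => Sum.inl (Sum.inr k)) ∪ {Sum.inr 1}) (by
      rw [Set.disjoint_left]
      rintro _ (⟨k, rfl⟩ | rfl) (⟨l, hl⟩ | hl) <;> simp at hl)
  exact h1.comp (φ := fun w => ((w.1, fun k => w.2 ⟨Sum.inl (Sum.inl k), Or.inl ⟨k, rfl⟩⟩),
      w.2 ⟨Sum.inr 0, Or.inr rfl⟩))
    (ψ := fun w => ((fun k => w ⟨Sum.inl (Sum.inr k), Or.inl ⟨k, rfl⟩⟩), w ⟨Sum.inr 1, Or.inr rfl⟩))
    (by fun_prop) (by fun_prop)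

end IsDownlinkNetwork

/-! ### Rayleigh fading with deterministic path losses -/

theorem integrable_sq_norm_complexGaussian (v : ℝ≥0) :
    Integrable (fun w : ℂ => ‖w‖ ^ 2) (complexGaussian v) := by
  rw [complexGaussian, integrable_map_measure (by fun_prop) measurable_complex_mk.aemeasurable]
  have h : Integrable (fun x : ℝ => x ^ 2) (gaussianReal 0 (v / 2)) :=
    MemLp.integrable_sq (by exact_mod_cast memLp_id_gaussianReal (μ := 0) (v := v / 2) 2)
  have h1 : Integrable (fun p : ℝ × ℝ => p.1 ^ 2) ((gaussianReal 0 (v / 2)).prod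
    (gaussianReal 0 (v / 2))) := h.comp_fst _
  have h2 : Integrable (fun p : ℝ × ℝ => p.2 ^ 2) ((gaussianReal 0 (v / 2)).prod
    (gaussianReal 0 (v / 2))) := h.comp_snd _
  refine (h1.add h2).congr (ae_of_all _ fun p => ?_)
  simp only [Pi.add_apply, Function.comp_apply, Complex.sq_norm, Complex.normSq_mk]
  ring

section Fading

variable {Ω : Type*} [MeasurableSpace Ω] {μ : Measure Ω} {h : ℕ → Ω → ℂ} {ρ : ℕ → ℝ}

/-- Since `E ‖h k‖²` is finite and the same for all `k`, Tonelli bounds the mean of the absolute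
series by a multiple of `∑ |ρ k|`. -/
theorem ae_summable_fading (hm : ∀ k, Measurable (h k))
    (hl : ∀ k, HasLaw (h k) (complexGaussian 1) μ) (hρ : Summable ρ) :
    ∀ᵐ ω ∂μ, Summable fun k => ‖h k ω‖ ^ 2 * ρ k := by
  set C := ∫⁻ w, ‖‖w‖ ^ 2‖ₑ ∂complexGaussian 1 with hC
  have hCt : C ≠ ∞ := (integrable_sq_norm_complexGaussian 1).2.ne
  have h1 : ∫⁻ ω, ∑' k, ‖‖h k ω‖ ^ 2 * ρ k‖ₑ ∂μ = C * ∑' k, ‖ρ k‖ₑ := by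
    rw [lintegral_tsum fun k => by have := hm k; fun_prop, ← ENNReal.tsum_mul_left]
    refine tsum_congr fun k => ?_
    simp only [enorm_mul]
    rw [lintegral_mul_const _ (by have := hm k; fun_prop), hC]
    congr 1
    exact (hl k).lintegral_comp (f := fun w => ‖‖w‖ ^ 2‖ₑ) (by fun_prop)
  have h2 : ∑' k, ‖ρ k‖ₑ ≠ ∞ := by
    have := hρ.norm
    simp only [enorm_eq_nnnorm]
    exact ENNReal.tsum_coe_ne_top_iff_summable.2 (NNReal.summable_coe.1 this)
  filter_upwards [ae_lt_top (by fun_prop) (h1 ▸ ENNReal.mul_ne_top hCt h2)] with ω hω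
  refine Summable.of_norm ?_
  simpa using ENNReal.summable_toReal hω.ne

/-- For finitely many terms independence gives `∏ (1 + ρ k)⁻¹`; dominated convergence does the rest.
The product is written with logarithms to have the shape required by the Laplace functional. -/
theorem integral_exp_neg_fading [IsProbabilityMeasure μ] (hm : ∀ k, Measurable (h k))
    (hl : ∀ k, HasLaw (h k) (complexGaussian 1) μ) (hi : iIndepFun h μ) (hρ0 : ∀ k, 0 ≤ ρ k)
    (hρ : Summable ρ) :
    ∫ ω, Real.exp (-∑' k, ‖h k ω‖ ^ 2 * ρ k) ∂μ = Real.exp (-∑' k, Real.log (1 + ρ k)) := by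
  have hlog : Summable fun k => Real.log (1 + ρ k) :=
    hρ.of_nonneg_of_le (fun k => Real.log_nonneg (by linarith [hρ0 k])) fun k => by
      have := Real.log_le_sub_one_of_pos (by linarith [hρ0 k] : 0 < 1 + ρ k)
      linarith
  have h1 : ∀ K, ∫ ω, Real.exp (-∑ k ∈ Finset.range K, ‖h k ω‖ ^ 2 * ρ k) ∂μ =
      Real.exp (-∑ k ∈ Finset.range K, Real.log (1 + ρ k)) := by
    intro K
    have h2 := (hi.comp (fun k w => Real.exp (-(ρ k * ‖w‖ ^ 2))) fun k => by fun_prop).precomp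
      (g := ((↑) : Finset.range K → ℕ)) Subtype.val_injective
    have h3 := h2.integral_fun_prod_eq_prod_integral fun k => by
      have := hm k
      exact (by fun_prop : Measurable fun ω => Real.exp (-(ρ k * ‖h k ω‖ ^ 2))).aestronglyMeasurable
    have h4 : ∀ k, ∫ ω, Real.exp (-(ρ k * ‖h k ω‖ ^ 2)) ∂μ = Real.exp (-Real.log (1 + ρ k)) := by
      intro k
      rw [Real.exp_neg, Real.exp_log (by linarith [hρ0 k]),
        ← integral_exp_neg_mul_sq_complexGaussian_one (hρ0 k)]
      exact (hl k).integral_comp (f := fun w => Real.exp (-(ρ k * ‖w‖ ^ 2))) (by fun_prop)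
    simp only [Function.comp_apply, h4] at h3
    rw [Finset.prod_coe_sort (Finset.range K) fun k => Real.exp (-Real.log (1 + ρ k))] at h3
    simp only [← Finset.sum_neg_distrib, Real.exp_sum]
    rw [← h3]
    refine integral_congr_ae (ae_of_all _ fun ω => ?_)
    simp only
    rw [Finset.prod_coe_sort (Finset.range K) fun k => Real.exp (-(ρ k * ‖h k ω‖ ^ 2))]
    exact Finset.prod_congr rfl fun k _ => by rw [mul_comm]
  have hR : Tendsto (fun K => Real.exp (-∑ k ∈ Finset.range K, Real.log (1 + ρ k))) atTop
      (𝓝 (Real.exp (-∑' k, Real.log (1 + ρ k)))) :=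
    (Real.continuous_exp.tendsto _).comp hlog.hasSum.tendsto_sum_nat.neg
  refine tendsto_nhds_unique (f := fun K =>
    Real.exp (-∑ k ∈ Finset.range K, Real.log (1 + ρ k))) ?_ hR
  simp only [← h1]
  refine tendsto_integral_of_dominated_convergence (fun _ => 1) (fun K => ?_)
    (integrable_const _) (fun K => ae_of_all _ fun ω => ?_) ?_
  · exact (by fun_prop : Measurable fun ω =>
      Real.exp (-∑ k ∈ Finset.range K, ‖h k ω‖ ^ 2 * ρ k)).aestronglyMeasurable
  · rw [Real.norm_of_nonneg (Real.exp_pos _).le, Real.exp_le_one_iff, neg_nonpos]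
    exact Finset.sum_nonneg fun k _ => mul_nonneg (sq_nonneg _) (hρ0 k)
  · filter_upwards [ae_summable_fading hm hl hρ] with ω hω
    exact (Real.continuous_exp.tendsto _).comp hω.hasSum.tendsto_sum_nat.neg

end Fading

/-! ### The aggregate interference power -/

/-- The interference power as a function of the point and fading sequences. -/
noncomputable def pathPower {E : Type*} [Norm E] (P η : ℝ) (ξ : ℕ → E) (w : ℕ → ℂ) : ℝ :=
  ∑' k, P * ‖w k‖ ^ 2 * ‖ξ k‖ ^ (-η)

theorem measurable_pathPower (P η : ℝ) :
    Measurable fun p : (ℕ → EuclideanSpace ℝ (Fin 2)) × (ℕ → ℂ) => pathPower P η p.1 p.2 :=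
  Measurable.tsum fun k => by fun_prop

theorem pathPower_nonneg {E : Type*} [SeminormedAddCommGroup E] {P η : ℝ} (hP : 0 ≤ P)
    (ξ : ℕ → E) (w : ℕ → ℂ) : 0 ≤ pathPower P η ξ w :=
  tsum_nonneg fun _ => by positivity

theorem sinr_nonneg {Ω : Type*} {P η r₀ : ℝ} {N₀ : ℝ≥0}
    {x : ℕ → Ω → EuclideanSpace ℝ (Fin 2)} {h : ℕ → Ω → ℂ} {h₀ : Ω → ℂ} (hP : 0 < P)
    (hr₀ : 0 < r₀) (ω : Ω) : 0 ≤ sinr P η r₀ N₀ x h h₀ ω := by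
  have : 0 ≤ interferencePower P η x h ω := pathPower_nonneg hP.le (fun k => x k ω) fun k => h k ω
  unfold sinr
  positivity

namespace IsDownlinkNetwork

variable {Ω : Type*} [MeasurableSpace Ω] {μ : Measure Ω} {P lam η r₀ : ℝ} {N₀ : ℝ≥0}
  {x : ℕ → Ω → EuclideanSpace ℝ (Fin 2)} {h s : ℕ → Ω → ℂ} {h₀ n : Ω → ℂ}

theorem measurable_interferencePower (hnet : IsDownlinkNetwork μ lam r₀ N₀ x h s h₀ n) :
    Measurable (interferencePower P η x h) := by
  have h1 := hnet.points.measurable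
  have h2 := hnet.measurable_h
  exact Measurable.tsum fun k => by fun_prop

theorem measurable_sinr (hnet : IsDownlinkNetwork μ lam r₀ N₀ x h s h₀ n) :
    Measurable (sinr P η r₀ N₀ x h h₀) := by
  have h1 := hnet.measurable_interferencePower (P := P) (η := η)
  have h2 := hnet.measurable_h₀
  unfold sinr
  fun_prop

theorem ae_lt_norm (hnet : IsDownlinkNetwork μ lam r₀ N₀ x h s h₀ n) :
    ∀ᵐ ω ∂μ, ∀ k, r₀ < ‖x k ω‖ := by
  have hm : MeasurableSet {y : EuclideanSpace ℝ (Fin 2) | r₀ < ‖y‖} :=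
    measurableSet_lt measurable_const measurable_norm
  refine hnet.points.ae_forall_mem hm ?_
  rw [Measure.smul_apply, Measure.restrict_apply hm.compl]
  simp

theorem integrable_norm_rpow (hη : 2 < η) (hr₀ : 0 < r₀) :
    Integrable (fun y : EuclideanSpace ℝ (Fin 2) => ‖y‖ ^ (-η))
      (ENNReal.ofReal lam • (volume : Measure (EuclideanSpace ℝ (Fin 2))).restrict {y | r₀ < ‖y‖}) :=
  (integrableOn_norm_rpow_neg hη hr₀).smul_measure ENNReal.ofReal_ne_top

theorem sigmaFinite_intensity : SigmaFinite
    (ENNReal.ofReal lam • (volume : Measure (EuclideanSpace ℝ (Fin 2))).restrict {y | r₀ < ‖y‖}) :=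
  inferInstanceAs (SigmaFinite (lam.toNNReal •
    (volume : Measure (EuclideanSpace ℝ (Fin 2))).restrict {y | r₀ < ‖y‖}))

theorem ae_summable_rpow (hnet : IsDownlinkNetwork μ lam r₀ N₀ x h s h₀ n) (hη : 2 < η)
    (hr₀ : 0 < r₀) : ∀ᵐ ω ∂μ, Summable fun k => ‖x k ω‖ ^ (-η) := by
  have := sigmaFinite_intensity (lam := lam) (r₀ := r₀)
  have hm : Measurable fun y : EuclideanSpace ℝ (Fin 2) => ‖y‖ ^ (-η) := by fun_prop
  have h1 := hnet.points.ae_summable hm (integrable_norm_rpow hη hr₀)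
  exact h1

theorem ae_ne_zero (hnet : IsDownlinkNetwork μ lam r₀ N₀ x h s h₀ n) : ∀ᵐ ω ∂μ, h₀ ω ≠ 0 := by
  refine (hnet.law_h₀.ae_iff (p := fun w => w ≠ 0) ?_).2 ?_
  · exact (measurableSet_singleton (0 : ℂ)).compl.mem
  · simpa [ae_iff] using complexGaussian_singleton_zero

theorem ae_h_ne_zero (hnet : IsDownlinkNetwork μ lam r₀ N₀ x h s h₀ n) (k : ℕ) :
    ∀ᵐ ω ∂μ, h k ω ≠ 0 := by
  refine ((hnet.law_h k).ae_iff (p := fun w => w ≠ 0) ?_).2 ?_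
  · exact (measurableSet_singleton (0 : ℂ)).compl.mem
  · simpa [ae_iff] using complexGaussian_singleton_zero

variable [IsProbabilityMeasure μ]

theorem ae_summable_power (hnet : IsDownlinkNetwork μ lam r₀ N₀ x h s h₀ n) (hη : 2 < η)
    (hr₀ : 0 < r₀) : ∀ᵐ ω ∂μ, Summable fun k => P * ‖h k ω‖ ^ 2 * ‖x k ω‖ ^ (-η) := by
  -- Convergence of partial sums is a measurable event; for these nonnegative terms it is the same
  -- as summability.
  have hA : MeasurableSet {p : (ℕ → EuclideanSpace ℝ (Fin 2)) × (ℕ → ℂ) |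
      ∃ l, Tendsto (fun K => ∑ k ∈ Finset.range K, ‖p.2 k‖ ^ 2 * ‖p.1 k‖ ^ (-η)) atTop (𝓝 l)} :=
    measurableSet_exists_tendsto fun K => by fun_prop
  have h0 : ∀ᵐ ω ∂μ, ∀ᵐ ω' ∂μ, ∃ l, Tendsto
      (fun K => ∑ k ∈ Finset.range K, ‖h k ω'‖ ^ 2 * ‖x k ω‖ ^ (-η)) atTop (𝓝 l) := by
    filter_upwards [hnet.ae_summable_rpow hη hr₀] with ω hω
    filter_upwards [ae_summable_fading hnet.measurable_h hnet.law_h hω] with ω' hω'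
    exact ⟨_, hω'.hasSum.tendsto_sum_nat⟩
  have h1 : ∀ᵐ ω ∂μ, ∃ l, Tendsto
      (fun K => ∑ k ∈ Finset.range K, ‖h k ω‖ ^ 2 * ‖x k ω‖ ^ (-η)) atTop (𝓝 l) :=
    ae_of_indepFun hnet.measurable_x hnet.measurable_h_seq hnet.indepFun_x_h hA h0
  filter_upwards [h1] with ω hω
  obtain ⟨l, hl⟩ := hω
  have h2 : Summable fun k => ‖h k ω‖ ^ 2 * ‖x k ω‖ ^ (-η) :=
    ((hasSum_iff_tendsto_nat_of_nonneg (fun k => by positivity) l).2 hl).summable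
  simpa only [mul_assoc] using h2.mul_left P

/-- The term `k = 0` is already positive. This keeps the SINR denominator away from zero even when
`N₀ = 0`. -/
theorem ae_interferencePower_pos (hnet : IsDownlinkNetwork μ lam r₀ N₀ x h s h₀ n) (hP : 0 < P)
    (hη : 2 < η) (hr₀ : 0 < r₀) : ∀ᵐ ω ∂μ, 0 < interferencePower P η x h ω := by
  filter_upwards [hnet.ae_summable_power (P := P) hη hr₀, hnet.ae_h_ne_zero 0, hnet.ae_lt_norm]
    with ω h1 h2 h3
  refine h1.tsum_pos (fun k => by positivity) 0 ?_
  have := hr₀.trans (h3 0)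
  positivity

/-- The Laplace transform of the aggregate interference power. -/
theorem integral_exp_neg_interferencePower (hnet : IsDownlinkNetwork μ lam r₀ N₀ x h s h₀ n)
    (hlam : 0 ≤ lam) (hP : 0 < P) (hη : 2 < η) (hr₀ : 0 < r₀) {t : ℝ} (ht : 0 ≤ t) :
    ∫ ω, Real.exp (-(t * interferencePower P η x h ω)) ∂μ =
      Real.exp (-(lam * ∫ y in {y : EuclideanSpace ℝ (Fin 2) | r₀ < ‖y‖},
        (1 - (1 + t * P * ‖y‖ ^ (-η))⁻¹))) := by
  have hm := measurable_pathPower P η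
  have hσ := sigmaFinite_intensity (lam := lam) (r₀ := r₀)
  have h1 := integral_comp_of_indepFun hnet.measurable_x hnet.measurable_h_seq hnet.indepFun_x_h
    (f := fun p => Real.exp (-(t * pathPower P η p.1 p.2))) (by fun_prop) (C := 1) fun p => by
      rw [Real.norm_of_nonneg (Real.exp_pos _).le, Real.exp_le_one_iff, neg_nonpos]
      exact mul_nonneg ht (pathPower_nonneg hP.le _ _)
  -- With this `g`, `1 - exp (-g)` in the Laplace functional is exactly `1 - (1 + t P ‖y‖^{-η})⁻¹`.
  set g : EuclideanSpace ℝ (Fin 2) → ℝ := fun y => Real.log (1 + t * P * ‖y‖ ^ (-η)) with hg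
  have hg1 : ∀ y : EuclideanSpace ℝ (Fin 2), 0 ≤ t * P * ‖y‖ ^ (-η) := fun y => by positivity
  have hg0 : ∀ y, 0 ≤ g y := fun y => Real.log_nonneg (by linarith [hg1 y])
  have hgm : Measurable g := by fun_prop
  have hgi : Integrable g (ENNReal.ofReal lam •
      (volume : Measure (EuclideanSpace ℝ (Fin 2))).restrict {y | r₀ < ‖y‖}) := by
    refine Integrable.mono' ((integrable_norm_rpow hη hr₀).const_mul (t * P))
      hgm.aestronglyMeasurable (ae_of_all _ fun y => ?_)
    rw [Real.norm_of_nonneg (hg0 y)]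
    have := Real.log_le_sub_one_of_pos (by linarith [hg1 y] : 0 < 1 + t * P * ‖y‖ ^ (-η))
    linarith
  have h2 : ∀ᵐ ω ∂μ, ∫ ω', Real.exp (-(t * pathPower P η (fun k => x k ω) fun k => h k ω')) ∂μ =
      Real.exp (-∑' k, g (x k ω)) := by
    filter_upwards [hnet.ae_summable_rpow hη hr₀] with ω hω
    rw [hg, ← integral_exp_neg_fading hnet.measurable_h hnet.law_h hnet.iIndepFun_h
      (fun k => hg1 (x k ω)) (hω.mul_left (t * P))]
    refine integral_congr_ae (ae_of_all _ fun ω' => ?_)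
    simp only [pathPower, ← tsum_mul_left]
    congr 2
    exact tsum_congr fun k => by ring
  refine h1.trans ((integral_congr_ae h2).trans ?_)
  rw [hnet.points.integral_exp_neg_tsum hgm hg0 hgi, integral_smul_measure,
    ENNReal.toReal_ofReal hlam, smul_eq_mul]
  congr 3
  refine integral_congr_ae (ae_of_all _ fun y => ?_)
  simp only [hg]
  rw [Real.exp_neg, Real.exp_log (by linarith [hg1 y])]

/-- The complementary distribution function of the SINR. -/
theorem measureReal_lt_sinr (hnet : IsDownlinkNetwork μ lam r₀ N₀ x h s h₀ n)
    (hlam : 0 ≤ lam) (hP : 0 < P) (hη : 2 < η) (hr₀ : 0 < r₀) {t : ℝ} (ht : 0 ≤ t) :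
    μ.real {ω | t < sinr P η r₀ N₀ x h h₀ ω} =
      Real.exp (-(t * (N₀ * r₀ ^ η / P)) -
        2 * Real.pi * lam * r₀ ^ 2 * (t / (η - 2) * eulerIntegral (1 - 2 / η) (-t))) := by
  -- The scale at which `t < Υ` reads `b (I + N₀) < ‖h₀‖²`.
  set b := t * r₀ ^ η / P with hb
  have hb0 : 0 ≤ b := by positivity
  have hm := measurable_pathPower P η
  set A : Set (((ℕ → EuclideanSpace ℝ (Fin 2)) × (ℕ → ℂ)) × ℂ) :=
    {p | b * (pathPower P η p.1.1 p.1.2 + N₀) < ‖p.2‖ ^ 2} with hA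
  have hAm : MeasurableSet A := measurableSet_lt (by fun_prop) (by fun_prop)
  have h1 : μ.real {ω | t < sinr P η r₀ N₀ x h h₀ ω} =
      μ.real {ω | (((fun k => x k ω, fun k => h k ω) : _ × _), h₀ ω) ∈ A} := by
    -- The events agree only almost surely: where the denominator vanishes, the SINR takes the
    -- default value `0`.
    refine measureReal_congr ?_
    filter_upwards [hnet.ae_interferencePower_pos hP hη hr₀] with ω hω
    refine propext ?_
    change t < P * ‖h₀ ω‖ ^ 2 * r₀ ^ (-η) / (interferencePower P η x h ω + N₀) ↔
      b * (interferencePower P η x h ω + N₀) < ‖h₀ ω‖ ^ 2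
    have h3 : 0 < interferencePower P η x h ω + N₀ := by positivity
    have h4 : 0 < r₀ ^ η := by positivity
    rw [lt_div_iff₀ h3, hb, Real.rpow_neg hr₀.le, ← div_eq_mul_inv, lt_div_iff₀ h4,
      div_mul_eq_mul_div, div_lt_iff₀ hP]
    rw [mul_comm (‖h₀ ω‖ ^ 2) P, mul_right_comm]
  rw [h1, measureReal_of_indepFun (hnet.measurable_x.prodMk hnet.measurable_h_seq)
    hnet.measurable_h₀ hnet.indepFun_xh_h₀ hAm]
  have h2 : ∀ ω, μ.real {ω' | (((fun k => x k ω, fun k => h k ω) : _ × _), h₀ ω') ∈ A} =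
      Real.exp (-(b * N₀)) * Real.exp (-(b * interferencePower P η x h ω)) := by
    intro ω
    have h3 : 0 ≤ interferencePower P η x h ω :=
      pathPower_nonneg hP.le (fun k => x k ω) fun k => h k ω
    have h4 : MeasurableSet {w : ℂ | b * (interferencePower P η x h ω + N₀) < ‖w‖ ^ 2} :=
      measurableSet_lt measurable_const (by fun_prop)
    rw [← Real.exp_add, show -(b * N₀) + -(b * interferencePower P η x h ω) =
      -(b * (interferencePower P η x h ω + N₀)) by ring,
      ← complexGaussian_one_tail (by positivity), ← hnet.law_h₀.map_eq,
      map_measureReal_apply hnet.measurable_h₀ h4]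
    rfl
  simp only [h2]
  rw [integral_const_mul, hnet.integral_exp_neg_interferencePower hlam hP hη hr₀ hb0,
    ← Real.exp_add]
  have h5 : ∀ y : EuclideanSpace ℝ (Fin 2),
      b * P * ‖y‖ ^ (-η) = t * (‖y‖ / r₀) ^ (-η) := by
    intro y
    rw [Real.div_rpow (norm_nonneg _) hr₀.le, Real.rpow_neg hr₀.le, hb]
    field_simp
  simp only [h5]
  rw [integral_plane_eq_eulerIntegral hη hr₀ ht]
  congr 1
  rw [hb]
  ring

end IsDownlinkNetwork

/-! ### The closed forms of the averaged error probability -/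

theorem qamBeta_pos {M : ℕ} (hM : 2 ≤ M) : 0 < qamBeta M := by
  have : (2 : ℝ) ≤ M := by exact_mod_cast hM
  have : (0 : ℝ) < M - 1 := by linarith
  unfold qamBeta
  positivity

/-- The factor `exp (-z)` of the kernel supplies the `1` in `1 + N₀ r₀^η / (P β)`; the rest is the
SINR tail at `z / β`. -/
theorem erfcKernel_mul_eq_asepIntegrand {M c : ℕ} {P lam η r₀ z : ℝ} {N₀ : ℝ≥0} (hM : 2 ≤ M)
    (hη : 2 < η) (hz : 0 < z) :
    erfcKernel c z * Real.exp (-(z / qamBeta M * (N₀ * r₀ ^ η / P)) -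
      2 * Real.pi * lam * r₀ ^ 2 *
        (z / qamBeta M / (η - 2) * eulerIntegral (1 - 2 / η) (-(z / qamBeta M)))) =
      c / √Real.pi * asepIntegrand M P lam η r₀ N₀ c z := by
  have hβ := qamBeta_pos hM
  have hb : 0 < 1 - 2 / η := by
    have : 2 / η < 1 := (div_lt_one (by linarith)).2 hη
    linarith
  have hz' : -z / qamBeta M < 1 := by
    have : 0 < z / qamBeta M := by positivity
    rw [neg_div]
    linarith
  rw [erfcKernel, asepIntegrand, show 2 - 2 / η = 1 - 2 / η + 1 by ring, gauss2F1_one_eq hb hz',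
    mul_assoc, mul_assoc, ← Real.exp_add, neg_div]
  congr 3
  field_simp
  ring

theorem asepIntegrand_four {M c : ℕ} {P lam r₀ z : ℝ} {N₀ : ℝ≥0} (hM : 2 ≤ M) (hz : 0 < z) :
    asepIntegrand M P lam 4 r₀ N₀ c z = asepIntegrandFour M P lam r₀ N₀ c z := by
  have hθ : 0 < z / qamBeta M := div_pos hz (qamBeta_pos hM)
  have h1 : gauss2F1 1 (1 - 2 / 4) (2 - 2 / 4) (-z / qamBeta M) =
      Real.arctan √(z / qamBeta M) / √(z / qamBeta M) := by
    rw [show (2 - 2 / 4 : ℝ) = 1 / 2 + 1 by norm_num, show (1 - 2 / 4 : ℝ) = 1 / 2 by norm_num,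
      neg_div, gauss2F1_one_eq (by norm_num) (by linarith), eulerIntegral_half hθ]
  have hs := Real.mul_self_sqrt hθ.le
  have hs0 : √(z / qamBeta M) ≠ 0 := (Real.sqrt_pos.2 hθ).ne'
  rw [asepIntegrand, asepIntegrandFour, h1, show r₀ ^ (4 : ℝ) = r₀ ^ 4 by norm_cast]
  congr 3
  rw [show 2 * Real.pi * lam * z * r₀ ^ 2 / (qamBeta M * (4 - 2)) =
    Real.pi * lam * r₀ ^ 2 * (z / qamBeta M) by field_simp; ring]
  have h2 : z / qamBeta M * (Real.arctan √(z / qamBeta M) / √(z / qamBeta M)) =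
      √(z / qamBeta M) * Real.arctan √(z / qamBeta M) := by
    rw [← mul_div_assoc, div_eq_iff hs0]
    linear_combination -Real.arctan √(z / qamBeta M) * hs
  linear_combination Real.pi * lam * r₀ ^ 2 * h2

/-! ### Minimum distance detection on a square grid -/

/-- The number of neighbours of the `k`-th of `m` consecutive grid points. -/
noncomputable def gridDegree (m k : ℕ) : ℝ :=
  (if 0 < k then 1 else 0) + (if k + 1 < m then 1 else 0)

/-- All but the first point have a left neighbour and all but the last a right one. -/
theorem sum_gridDegree {m : ℕ} (hm : 1 ≤ m) : ∑ k : Fin m, gridDegree m k = 2 * (m - 1) := by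
  obtain ⟨m, rfl⟩ := Nat.exists_eq_add_of_le' hm
  rw [Fin.sum_univ_eq_sum_range fun k => gridDegree (m + 1) k]
  simp only [gridDegree, Finset.sum_add_distrib]
  rw [Finset.sum_range_succ', Finset.sum_range_succ]
  have h1 : ∀ k ∈ Finset.range m, (if k + 1 < m + 1 then (1 : ℝ) else 0) = 1 := fun k hk => by
    simpa using Finset.mem_range.1 hk
  rw [Finset.sum_congr rfl h1]
  simp
  ring

/-- The decision region in one coordinate: `x > -T` if there is a left neighbour, `x < T` if there
is a right neighbour. -/
def gridInterval (m k : ℕ) (T : ℝ) : Set ℝ := {x | (0 < k → -T < x) ∧ (k + 1 < m → x < T)}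

theorem measurableSet_gridInterval (m k : ℕ) (T : ℝ) : MeasurableSet (gridInterval m k T) := by
  have h : gridInterval m k T = (if 0 < k then Set.Ioi (-T) else Set.univ) ∩
      (if k + 1 < m then Set.Iio T else Set.univ) := by
    ext x
    by_cases h1 : 0 < k <;> by_cases h2 : k + 1 < m <;> simp [gridInterval, h1, h2]
  rw [h]
  refine MeasurableSet.inter ?_ ?_ <;> split_ifs <;> simp

theorem complexGaussian_gridInterval {v : ℝ≥0} (hv : v ≠ 0) {T : ℝ} (hT : 0 < T) (m k l : ℕ) :
    (complexGaussian v).real {w | w.re ∈ gridInterval m k T ∧ w.im ∈ gridInterval m l T} =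
      (1 - gridDegree m k * (erfc (T / √v) / 2)) * (1 - gridDegree m l * (erfc (T / √v) / 2)) := by
  have hv' : (0 : ℝ) < v := by positivity
  have hv2 : v / 2 ≠ 0 := by positivity
  -- Each coordinate has variance `v / 2`, so the length unit of `gaussianReal_interval` is `√v`.
  have h1 : √(2 * ((v / 2 : ℝ≥0) : ℝ)) * (T / √v) = T := by
    push_cast
    rw [mul_div_cancel₀ _ (two_ne_zero (α := ℝ))]
    exact mul_div_cancel₀ _ (Real.sqrt_pos.2 hv').ne'
  have h2 : ∀ k, (gaussianReal 0 (v / 2)).real (gridInterval m k T) =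
      1 - gridDegree m k * (erfc (T / √v) / 2) := by
    intro k
    have h3 := gaussianReal_interval hv2 (ρ := T / √v) (by positivity) (0 < k) (k + 1 < m)
    rw [h1] at h3
    exact h3
  rw [complexGaussian_reProd v (measurableSet_gridInterval m k T)
    (measurableSet_gridInterval m l T), h2, h2]

/-- The expression factors as `(k - j)(X + T (k - j))`. As `|k - j| ≥ 1` for `j ≠ k`, the constraint
from the adjacent point implies those from all farther points on its side. -/
theorem mul_add_sq_nonneg_of_mem_gridInterval {m : ℕ} {k j : Fin m} {T X : ℝ} (hT : 0 < T)
    (hX : X ∈ gridInterval m k T) :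
    0 ≤ ((k : ℝ) - j) * X + T * ((k : ℝ) - j) ^ 2 ∧
      (j ≠ k → 0 < ((k : ℝ) - j) * X + T * ((k : ℝ) - j) ^ 2) := by
  rcases lt_trichotomy j k with hjk | rfl | hjk
  · have h1 : (j : ℝ) + 1 ≤ k := by exact_mod_cast hjk
    have h2 : -T < X := hX.1 (by have : (j : ℕ) < k := hjk; omega)
    have h3 : 0 < ((k : ℝ) - j) * (X + T * ((k : ℝ) - j)) :=
      mul_pos (by linarith) (by nlinarith)
    have h4 : 0 < ((k : ℝ) - j) * X + T * ((k : ℝ) - j) ^ 2 := by linarith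
    exact ⟨h4.le, fun _ => h4⟩
  · simp
  · have h1 : (k : ℝ) + 1 ≤ j := by exact_mod_cast hjk
    have h2 : X < T := hX.2 (by have : (k : ℕ) < j := hjk; have := j.2; omega)
    have h3 : 0 < ((j : ℝ) - k) * (T * ((j : ℝ) - k) - X) :=
      mul_pos (by linarith) (by nlinarith)
    have h4 : 0 < ((k : ℝ) - j) * X + T * ((k : ℝ) - j) ^ 2 := by linarith
    exact ⟨h4.le, fun _ => h4⟩

/-- Testing against the adjacent points gives the interval constraints. Conversely both coordinate
terms are nonnegative, and one is strict because `j ≠ i`. -/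
theorem forall_grid_iff {m : ℕ} (i : Fin m × Fin m) {T X Y : ℝ} (hT : 0 < T) :
    (∀ j : Fin m × Fin m, j ≠ i →
      0 < (((i.1 : ℝ) - j.1) * X + T * ((i.1 : ℝ) - j.1) ^ 2) +
        (((i.2 : ℝ) - j.2) * Y + T * ((i.2 : ℝ) - j.2) ^ 2)) ↔
      X ∈ gridInterval m i.1 T ∧ Y ∈ gridInterval m i.2 T := by
  constructor
  · intro h
    refine ⟨⟨fun hi => ?_, fun hi => ?_⟩, ⟨fun hi => ?_, fun hi => ?_⟩⟩
    · have h1 := h (⟨i.1 - 1, by omega⟩, i.2) fun h2 => by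
        have := congrArg (fun p : Fin m × Fin m => (p.1 : ℕ)) h2
        simp only at this
        omega
      simp only [Nat.cast_sub (show 1 ≤ (i.1 : ℕ) from hi)] at h1
      norm_num at h1
      linarith
    · have h1 := h (⟨i.1 + 1, hi⟩, i.2) fun h2 => by
        have := congrArg (fun p : Fin m × Fin m => (p.1 : ℕ)) h2
        simp at this
      norm_num at h1
      linarith
    · have h1 := h (i.1, ⟨i.2 - 1, by omega⟩) fun h2 => by
        have := congrArg (fun p : Fin m × Fin m => (p.2 : ℕ)) h2
        simp only at this
        omega
      simp only [Nat.cast_sub (show 1 ≤ (i.2 : ℕ) from hi)] at h1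
      norm_num at h1
      linarith
    · have h1 := h (i.1, ⟨i.2 + 1, hi⟩) fun h2 => by
        have := congrArg (fun p : Fin m × Fin m => (p.2 : ℕ)) h2
        simp at this
      norm_num at h1
      linarith
  · rintro ⟨hX, hY⟩ j hj
    have h1 := mul_add_sq_nonneg_of_mem_gridInterval (j := j.1) hT hX
    have h2 := mul_add_sq_nonneg_of_mem_gridInterval (j := j.2) hT hY
    by_cases h3 : j.1 = i.1
    · exact add_pos_of_nonneg_of_pos h1.1 (h2.2 fun h4 => hj (Prod.ext h3 h4))
    · exact add_pos_of_pos_of_nonneg (h1.2 h3) h2.1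

/-- Half the spacing of the `m²`-point grid of unit power. -/
noncomputable def qamHalfSpacing (m : ℕ) : ℝ := √(3 / (2 * ((m : ℝ) ^ 2 - 1)))

/-- Correct detection in terms of the noise `R` rotated by the phase of the channel `g`. -/
theorem detection_iff {m : ℕ} (i : Fin m × Fin m) {κ : ℝ} {g R : ℂ} (hκ : 0 < κ) (hg : g ≠ 0)
    (hδ : 0 < qamHalfSpacing m) :
    (∀ j, j ≠ i → ‖R‖ < ‖(κ : ℂ) * (squareQAM m i - squareQAM m j) * g + R‖) ↔
      ((starRingEnd ℂ) g / ‖g‖ * R).re ∈ gridInterval m i.1 (κ * qamHalfSpacing m * ‖g‖) ∧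
      ((starRingEnd ℂ) g / ‖g‖ * R).im ∈ gridInterval m i.2 (κ * qamHalfSpacing m * ‖g‖) := by
  set u : ℂ := (starRingEnd ℂ) g / ‖g‖ with hu
  set T : ℝ := κ * qamHalfSpacing m * ‖g‖ with hT
  have hg0 : 0 < ‖g‖ := norm_pos_iff.2 hg
  have hT0 : 0 < T := by positivity
  have hu1 : ‖u‖ = 1 := by
    rw [hu, norm_div, RCLike.norm_conj]
    simp [hg0.ne']
  -- Multiplication by `u` makes the channel real and positive, so the received grid is aligned with
  -- the axes and the comparison of distances splits into coordinates.
  have hug : u * g = ‖g‖ := by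
    have h1 : (‖g‖ : ℂ) ≠ 0 := by exact_mod_cast hg0.ne'
    rw [hu, div_mul_eq_mul_div, Complex.conj_mul', sq, mul_div_assoc, div_self h1, mul_one]
  rw [← forall_grid_iff i hT0]
  refine forall_congr' fun j => imp_congr_right fun _ => ?_
  have h1 : ‖R‖ = ‖u * R‖ := by rw [norm_mul, hu1, one_mul]
  have h2 : ‖(κ : ℂ) * (squareQAM m i - squareQAM m j) * g + R‖ =
      ‖(⟨2 * T * ((i.1 : ℝ) - j.1), 2 * T * ((i.2 : ℝ) - j.2)⟩ : ℂ) + u * R‖ := by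
    rw [← one_mul ‖(κ : ℂ) * (squareQAM m i - squareQAM m j) * g + R‖, ← hu1, ← norm_mul, mul_add,
      show u * ((κ : ℂ) * (squareQAM m i - squareQAM m j) * g) =
        (κ : ℂ) * (squareQAM m i - squareQAM m j) * (u * g) by ring, hug]
    congr 2
    have hq : ∀ j, squareQAM m j = (qamHalfSpacing m : ℂ) *
        ⟨2 * (j.1.val : ℝ) - (m - 1), 2 * (j.2.val : ℝ) - (m - 1)⟩ := fun _ => rfl
    rw [hq, hq, hT]
    apply Complex.ext <;> simp <;> ring
  rw [h1, h2, ← sq_lt_sq₀ (norm_nonneg _) (norm_nonneg _), Complex.sq_norm, Complex.sq_norm,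
    Complex.normSq_apply, Complex.normSq_apply, ← sub_pos]
  simp only [Complex.add_re, Complex.add_im]
  rw [show ∀ a b X Y : ℝ, (2 * T * a + X) * (2 * T * a + X) + (2 * T * b + Y) * (2 * T * b + Y) -
    (X * X + Y * Y) = 4 * T * ((a * X + T * a ^ 2) + (b * Y + T * b ^ 2)) by intros; ring]
  exact mul_pos_iff_of_pos_left (by positivity)

theorem norm_pathGain_sq {P η r : ℝ} (hP : 0 ≤ P) (hr : 0 ≤ r) (w : ℂ) :
    ‖((√P * r ^ (-η / 2) : ℝ) : ℂ) * w‖ ^ 2 = P * ‖w‖ ^ 2 * r ^ (-η) := by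
  have h1 : (r ^ (-η / 2)) ^ 2 = r ^ (-η) := by
    rw [← Real.rpow_natCast, ← Real.rpow_mul hr]
    congr 1
    push_cast
    ring
  rw [norm_mul, Complex.norm_real, mul_pow, Real.norm_eq_abs, sq_abs, mul_pow, Real.sq_sqrt hP, h1]
  ring

theorem summable_nnnorm_gain {Ω E : Type*} [SeminormedAddCommGroup E] {P η : ℝ}
    {x : ℕ → Ω → E} {h : ℕ → Ω → ℂ} (hP : 0 ≤ P) {ω : Ω}
    (hω : Summable fun k => P * ‖h k ω‖ ^ 2 * ‖x k ω‖ ^ (-η)) :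
    Summable fun k => ‖((√P * ‖x k ω‖ ^ (-η / 2) : ℝ) : ℂ) * h k ω‖₊ ^ 2 := by
  rw [← NNReal.summable_coe]
  refine hω.congr fun k => ?_
  rw [NNReal.coe_pow, coe_nnnorm, norm_pathGain_sq hP (norm_nonneg _)]

/-- Interference plus noise as a function of the points, the fading coefficients, the interfering
symbols and the noise. -/
noncomputable def interferenceNoise {E : Type*} [Norm E] (P η : ℝ)
    (p : (((ℕ → E) × (ℕ → ℂ)) × ℂ) × ((ℕ → ℂ) × ℂ)) : ℂ :=
  limUnder atTop (fun K : ℕ => ∑ k ∈ Finset.range K,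
    ((√P * ‖p.1.1.1 k‖ ^ (-η / 2) : ℝ) : ℂ) * p.2.1 k * p.1.1.2 k) + p.2.2

theorem measurable_interferenceNoise (P η : ℝ) :
    Measurable (interferenceNoise (E := EuclideanSpace ℝ (Fin 2)) P η) :=
  Measurable.add (StronglyMeasurable.limUnder fun K => Measurable.stronglyMeasurable
    (by fun_prop)).measurable (by fun_prop)

/-! ### Detection error and averaged error probability in the network -/

namespace IsDownlinkNetwork

variable {Ω : Type*} [MeasurableSpace Ω] {μ : Measure Ω} {P lam η r₀ : ℝ} {N₀ : ℝ≥0}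
  {x : ℕ → Ω → EuclideanSpace ℝ (Fin 2)} {h s : ℕ → Ω → ℂ} {h₀ n : Ω → ℂ}

theorem measurable_xhh₀ (hnet : IsDownlinkNetwork μ lam r₀ N₀ x h s h₀ n) :
    Measurable fun ω => (((fun k => x k ω), (fun k => h k ω)), h₀ ω) :=
  (hnet.measurable_x.prodMk hnet.measurable_h_seq).prodMk hnet.measurable_h₀

theorem measurable_sn (hnet : IsDownlinkNetwork μ lam r₀ N₀ x h s h₀ n) :
    Measurable fun ω => ((fun k => s k ω), n ω) := hnet.measurable_s_seq.prodMk hnet.measurable_n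

variable [IsProbabilityMeasure μ]

/-- The interference signal converges almost surely. -/
theorem ae_tendsto_aggInterference (hnet : IsDownlinkNetwork μ lam r₀ N₀ x h s h₀ n) (hP : 0 < P)
    (hη : 2 < η) (hr₀ : 0 < r₀) :
    ∀ᵐ ω ∂μ, Tendsto (fun K : ℕ => ∑ k ∈ Finset.range K, interferenceTerm P η x h s k ω)
      atTop (𝓝 (aggInterference P η x h s ω)) := by
  have hA : MeasurableSet {p : (((ℕ → EuclideanSpace ℝ (Fin 2)) × (ℕ → ℂ)) × ℂ) × ((ℕ → ℂ) × ℂ) |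
      ∃ l, Tendsto (fun K : ℕ => ∑ k ∈ Finset.range K,
        ((√P * ‖p.1.1.1 k‖ ^ (-η / 2) : ℝ) : ℂ) * p.2.1 k * p.1.1.2 k) atTop (𝓝 l)} :=
    measurableSet_exists_tendsto fun K => by fun_prop
  have h0 : ∀ᵐ ω ∂μ, ∀ᵐ ω' ∂μ, ∃ l, Tendsto (fun K : ℕ => ∑ k ∈ Finset.range K,
      ((√P * ‖x k ω‖ ^ (-η / 2) : ℝ) : ℂ) * s k ω' * h k ω) atTop (𝓝 l) := by
    filter_upwards [hnet.ae_summable_power (P := P) hη hr₀] with ω hω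
    filter_upwards [ae_exists_tendsto_sum_mul hnet.measurable_s hnet.law_s hnet.iIndepFun_s
      (summable_nnnorm_gain hP.le hω)] with ω' hω'
    simpa only [mul_right_comm] using hω'
  have h1 : ∀ᵐ ω ∂μ, ∃ l, Tendsto (fun K : ℕ => ∑ k ∈ Finset.range K,
      ((√P * ‖x k ω‖ ^ (-η / 2) : ℝ) : ℂ) * s k ω * h k ω) atTop (𝓝 l) :=
    ae_of_indepFun hnet.measurable_xhh₀ hnet.measurable_sn hnet.indepFun_xhh₀_sn hA h0
  filter_upwards [h1] with ω hω
  exact tendsto_nhds_limUnder hω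

/-- Given the points and the fading, interference plus noise is complex Gaussian. -/
theorem ae_hasLaw_interferenceNoise (hnet : IsDownlinkNetwork μ lam r₀ N₀ x h s h₀ n) (hP : 0 < P)
    (hη : 2 < η) (hr₀ : 0 < r₀) :
    ∀ᵐ ω ∂μ, HasLaw (fun ω' => interferenceNoise P η
        ((((fun k => x k ω), (fun k => h k ω)), h₀ ω), ((fun k => s k ω'), n ω')))
      (complexGaussian ((interferencePower P η x h ω).toNNReal + N₀)) μ := by
  filter_upwards [hnet.ae_summable_power (P := P) hη hr₀] with ω hω
  have h1 := hasLaw_limUnder_add hnet.measurable_s hnet.law_s hnet.iIndepFun_s hnet.law_n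
    hnet.indepFun_s_n (summable_nnnorm_gain hP.le hω)
  have h2 : (interferencePower P η x h ω).toNNReal =
      ∑' k, ‖((√P * ‖x k ω‖ ^ (-η / 2) : ℝ) : ℂ) * h k ω‖₊ ^ 2 := by
    rw [← Real.toNNReal_coe (r := ∑' k, _), NNReal.coe_tsum]
    congr 1
    refine tsum_congr fun k => ?_
    rw [NNReal.coe_pow, coe_nnnorm, norm_pathGain_sq hP.le (norm_nonneg _)]
  rw [h2]
  simpa only [interferenceNoise, mul_right_comm] using h1

/-- The probability that the detector errs for a given symbol. -/
theorem measureReal_detection_error (hnet : IsDownlinkNetwork μ lam r₀ N₀ x h s h₀ n)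
    (hP : 0 < P) (hη : 2 < η) (hr₀ : 0 < r₀) {m : ℕ} (hm : 2 ≤ m ^ 2) (i : Fin m × Fin m) :
    μ.real {ω | ∃ j, j ≠ i ∧
      ‖received P η r₀ x h s h₀ n (squareQAM m i) ω -
        ((√P * r₀ ^ (-η / 2) : ℝ) : ℂ) * squareQAM m j * h₀ ω‖ ≤
      ‖received P η r₀ x h s h₀ n (squareQAM m i) ω -
        ((√P * r₀ ^ (-η / 2) : ℝ) : ℂ) * squareQAM m i * h₀ ω‖} =
    (gridDegree m i.1 + gridDegree m i.2) / 2 *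
        (∫ ω, erfc √(qamBeta (m ^ 2) * sinr P η r₀ N₀ x h h₀ ω) ∂μ) -
      gridDegree m i.1 * gridDegree m i.2 / 4 *
        ∫ ω, erfc √(qamBeta (m ^ 2) * sinr P η r₀ N₀ x h h₀ ω) ^ 2 ∂μ := by
  set κ : ℝ := √P * r₀ ^ (-η / 2) with hκdef
  have hκ : 0 < κ := by positivity
  have hβ := qamBeta_pos hm
  -- The QAM factor `β` is the squared half-spacing of the grid.
  have hδβ : qamHalfSpacing m = √(qamBeta (m ^ 2)) := by
    rw [qamHalfSpacing, qamBeta]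
    push_cast
    rfl
  have hδ : 0 < qamHalfSpacing m := hδβ ▸ Real.sqrt_pos.2 hβ
  set Z := fun ω => (((fun k => x k ω), (fun k => h k ω)), h₀ ω) with hZ
  set S := fun ω => ((fun k => s k ω), n ω) with hS
  have hZm : Measurable Z := hnet.measurable_xhh₀
  have hSm : Measurable S := hnet.measurable_sn
  have hRm := measurable_interferenceNoise P η
  set A : Set ((((ℕ → EuclideanSpace ℝ (Fin 2)) × (ℕ → ℂ)) × ℂ) × ((ℕ → ℂ) × ℂ)) :=
    {p | ∀ j, j ≠ i → ‖interferenceNoise P η p‖ <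
      ‖(κ : ℂ) * (squareQAM m i - squareQAM m j) * p.1.2 + interferenceNoise P η p‖} with hA
  have hAm : MeasurableSet A := by
    have : A = ⋂ j, ⋂ (_ : j ≠ i), {p | ‖interferenceNoise P η p‖ <
        ‖(κ : ℂ) * (squareQAM m i - squareQAM m j) * p.1.2 + interferenceNoise P η p‖} := by
      ext p; simp [hA]
    rw [this]
    exact MeasurableSet.iInter fun j => MeasurableSet.iInter fun _ =>
      measurableSet_lt (by fun_prop) (by fun_prop)
  have hset : {ω | ∃ j, j ≠ i ∧
      ‖received P η r₀ x h s h₀ n (squareQAM m i) ω - (κ : ℂ) * squareQAM m j * h₀ ω‖ ≤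
      ‖received P η r₀ x h s h₀ n (squareQAM m i) ω - (κ : ℂ) * squareQAM m i * h₀ ω‖} =
      {ω | (Z ω, S ω) ∈ A}ᶜ := by
    ext ω
    have h1 : ∀ j, received P η r₀ x h s h₀ n (squareQAM m i) ω - (κ : ℂ) * squareQAM m j * h₀ ω =
        (κ : ℂ) * (squareQAM m i - squareQAM m j) * h₀ ω + interferenceNoise P η (Z ω, S ω) := by
      intro j
      have h2 : interferenceNoise P η (Z ω, S ω) = aggInterference P η x h s ω + n ω := rfl
      rw [h2, received]
      ring
    simp only [Set.mem_ofPred_eq, Set.mem_compl_iff, hA, not_forall, not_lt, exists_prop, h1,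
      sub_self, mul_zero, zero_mul, zero_add]
    rfl
  set e : Ω → ℝ := fun ω => erfc √(qamBeta (m ^ 2) * sinr P η r₀ N₀ x h h₀ ω) with he
  have hem : Measurable e := continuous_erfc.measurable.comp
    ((hnet.measurable_sinr.const_mul _).sqrt)
  have he1 : ∀ ω, ‖e ω‖ ≤ 1 := fun ω => by
    rw [Real.norm_of_nonneg (erfc_nonneg _)]
    exact erfc_le_one (Real.sqrt_nonneg _)
  have hei : Integrable e μ :=
    (integrable_const (1 : ℝ)).mono' hem.aestronglyMeasurable (ae_of_all _ he1)
  have hei2 : Integrable (fun ω => e ω ^ 2) μ :=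
    (integrable_const (1 : ℝ)).mono' (hem.pow_const 2).aestronglyMeasurable (ae_of_all _ fun ω => by
      rw [norm_pow]; exact pow_le_one₀ (norm_nonneg _) (he1 ω))
  have hcond : ∀ᵐ ω ∂μ, μ.real {ω' | (Z ω, S ω') ∈ A} =
      1 - ((gridDegree m i.1 + gridDegree m i.2) / 2 * e ω -
        gridDegree m i.1 * gridDegree m i.2 / 4 * e ω ^ 2) := by
    filter_upwards [hnet.ae_hasLaw_interferenceNoise hP hη hr₀, hnet.ae_ne_zero,
      hnet.ae_interferencePower_pos hP hη hr₀] with ω hlaw hg hI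
    set v : ℝ≥0 := (interferencePower P η x h ω).toNNReal + N₀ with hv
    have hvI : (v : ℝ) = interferencePower P η x h ω + N₀ := by
      rw [hv, NNReal.coe_add, Real.coe_toNNReal _ hI.le]
    have hv0 : v ≠ 0 := by
      have : (0 : ℝ) < v := by rw [hvI]; positivity
      exact_mod_cast this.ne'
    set T : ℝ := κ * qamHalfSpacing m * ‖h₀ ω‖ with hT
    have hg0 : 0 < ‖h₀ ω‖ := norm_pos_iff.2 hg
    have hT0 : 0 < T := by positivity
    set u : ℂ := (starRingEnd ℂ) (h₀ ω) / ‖h₀ ω‖ with hu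
    have hu1 : ‖u‖₊ = 1 := by
      ext
      rw [coe_nnnorm, hu, norm_div, RCLike.norm_conj]
      simp [hg0.ne']
    set B : Set ℂ := {w | w.re ∈ gridInterval m i.1 T ∧ w.im ∈ gridInterval m i.2 T} with hB
    have hBm : MeasurableSet B :=
      (Complex.measurable_re (measurableSet_gridInterval m i.1 T)).inter
        (Complex.measurable_im (measurableSet_gridInterval m i.2 T))
    have h1 : {ω' | (Z ω, S ω') ∈ A} =
        (fun ω' => interferenceNoise P η (Z ω, S ω')) ⁻¹' ((fun w => u * w) ⁻¹' B) := by
      ext ω'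
      exact detection_iff i hκ hg hδ
    have h2 : (complexGaussian v).real ((fun w => u * w) ⁻¹' B) = (complexGaussian v).real B := by
      rw [← map_measureReal_apply (by fun_prop) hBm, complexGaussian_map_mul, hu1]
      simp
    -- Half the received spacing divided by the root of the interference-plus-noise power: here the
    -- SINR enters.
    have h3 : T / √v = √(qamBeta (m ^ 2) * sinr P η r₀ N₀ x h h₀ ω) := by
      have h4 : P * ‖h₀ ω‖ ^ 2 * r₀ ^ (-η) = (κ * ‖h₀ ω‖) ^ 2 := by
        rw [← norm_pathGain_sq hP.le hr₀.le, norm_mul, Complex.norm_real,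
          Real.norm_of_nonneg hκ.le]
      rw [sinr, ← hvI, h4, Real.sqrt_mul hβ.le, Real.sqrt_div (sq_nonneg _),
        Real.sqrt_sq (by positivity), ← hδβ, hT]
      ring
    have hsm : Measurable fun ω' => interferenceNoise P η (Z ω, S ω') :=
      hRm.comp (measurable_prodMk_left.comp hSm)
    rw [h1, ← map_measureReal_apply hsm ((by fun_prop : Measurable fun w : ℂ => u * w) hBm),
      show μ.map (fun ω' => interferenceNoise P η (Z ω, S ω')) = complexGaussian v from hlaw.map_eq,
      h2, hB, complexGaussian_gridInterval hv0 hT0, h3]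
    simp only [he]
    ring
  have hcompl : μ.real {ω | (Z ω, S ω) ∈ A}ᶜ = 1 - μ.real {ω | (Z ω, S ω) ∈ A} :=
    probReal_compl_eq_one_sub ((hZm.prodMk hSm) hAm)
  change _ = _ - _ * ∫ ω, e ω ^ 2 ∂μ
  rw [hset, hcompl, measureReal_of_indepFun hZm hSm hnet.indepFun_xhh₀_sn hAm,
    integral_congr_ae hcond,
    integral_sub (integrable_const _) (by fun_prop),
    integral_sub (hei.const_mul _) (hei2.const_mul _), integral_const_mul, integral_const_mul]
  simp

/-- The degree has average `2 (m - 1) / m` in each direction, and the average over the square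
factorises, so the coefficients become `w₁` and `w₂`. -/
theorem symbolErrorProb_eq_asep (hnet : IsDownlinkNetwork μ lam r₀ N₀ x h s h₀ n)
    (hP : 0 < P) (hη : 2 < η) (hr₀ : 0 < r₀) {m : ℕ} (hm : 2 ≤ m ^ 2) :
    symbolErrorProb μ (squareQAM m) P η r₀ x h s h₀ n = asep μ (m ^ 2) P η r₀ N₀ x h h₀ := by
  have hm1 : 1 ≤ m := by
    rcases Nat.eq_zero_or_pos m with rfl | h1
    · simp at hm
    · exact h1
  have hm0 : (m : ℝ) ≠ 0 := by positivity
  rw [symbolErrorProb, asep]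
  simp only [hnet.measureReal_detection_error hP hη hr₀ hm]
  rw [Finset.sum_sub_distrib, ← Finset.sum_mul, ← Finset.sum_mul, ← Finset.sum_div,
    ← Finset.sum_div, Finset.sum_add_distrib, Fintype.sum_prod_type, Fintype.sum_prod_type,
    Fintype.sum_prod_type]
  simp only [← Finset.mul_sum, ← Finset.sum_mul, Finset.sum_const, sum_gridDegree hm1,
    Fintype.card_prod, Fintype.card_fin, Finset.card_univ, nsmul_eq_mul]
  have hs : √((m ^ 2 : ℕ) : ℝ) = m := by
    push_cast
    exact Real.sqrt_sq (Nat.cast_nonneg m)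
  simp only [qamWeight, hs]
  push_cast
  norm_num
  field_simp
  ring

/-- Up to the factor `c / √π` the integrand is the kernel times a tail probability of the SINR; this
probability is at most `1`, which gives integrability. -/
theorem integral_erfc_sinr (hnet : IsDownlinkNetwork μ lam r₀ N₀ x h s h₀ n)
    (hlam : 0 ≤ lam) (hP : 0 < P) (hη : 2 < η) (hr₀ : 0 < r₀) {M c : ℕ} (hM : 2 ≤ M)
    (hc : c = 1 ∨ c = 2) :
    IntegrableOn (asepIntegrand M P lam η r₀ N₀ c) (Set.Ioi 0) ∧
    ∫ ω, erfc √(qamBeta M * sinr P η r₀ N₀ x h h₀ ω) ^ c ∂μ =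
      1 - c / √Real.pi * ∫ z in Set.Ioi (0 : ℝ), asepIntegrand M P lam η r₀ N₀ c z := by
  have hβ := qamBeta_pos hM
  have hY : Measurable fun ω => qamBeta M * sinr P η r₀ N₀ x h h₀ ω :=
    hnet.measurable_sinr.const_mul _
  have hc0 : (c : ℝ) / √Real.pi ≠ 0 := by
    have : 0 < √Real.pi := Real.sqrt_pos.2 Real.pi_pos
    rcases hc with rfl | rfl <;> positivity
  have hker : ∀ z ∈ Set.Ioi (0 : ℝ),
      erfcKernel c z * μ.real {ω | z < qamBeta M * sinr P η r₀ N₀ x h h₀ ω} =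
        c / √Real.pi * asepIntegrand M P lam η r₀ N₀ c z := by
    intro z hz
    rw [← erfcKernel_mul_eq_asepIntegrand hM hη hz,
      ← hnet.measureReal_lt_sinr hlam hP hη hr₀ (div_nonneg (le_of_lt hz) hβ.le)]
    simp only [div_lt_iff₀' hβ]
  -- Monotonicity gives measurability of the tail in `z`.
  have hanti : Antitone fun z => μ.real {ω | z < qamBeta M * sinr P η r₀ N₀ x h h₀ ω} :=
    fun a b hab => measureReal_mono fun ω hω => lt_of_le_of_lt hab hω
  refine ⟨?_, ?_⟩
  · have h1 : IntegrableOn (fun z => erfcKernel c z *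
        μ.real {ω | z < qamBeta M * sinr P η r₀ N₀ x h h₀ ω}) (Set.Ioi 0) := by
      refine Integrable.mono' (integrableOn_erfcKernel c)
        ((measurable_erfcKernel c).mul hanti.measurable).aestronglyMeasurable
        (ae_of_all _ fun z => ?_)
      rw [Real.norm_of_nonneg (mul_nonneg (erfcKernel_nonneg c z) measureReal_nonneg)]
      exact mul_le_of_le_one_right (erfcKernel_nonneg c z) measureReal_le_one
    have h2 := (h1.congr_fun hker measurableSet_Ioi).const_mul ((c : ℝ) / √Real.pi)⁻¹
    simp only [inv_mul_cancel_left₀ hc0] at h2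
    exact h2
  · rw [integral_erfc_sqrt_pow hc hY fun ω => mul_nonneg hβ.le (sinr_nonneg hP hr₀ ω),
      setIntegral_congr_fun measurableSet_Ioi hker, integral_const_mul]

end IsDownlinkNetwork

/-! ### The theorem assembled -/

theorem mainTheorem3 {Ω : Type*} [MeasurableSpace Ω] (μ : Measure Ω) [IsProbabilityMeasure μ]
    (M : ℕ) (P lam η r₀ : ℝ) (N₀ : ℝ≥0)
    (hM : 2 ≤ M) (hP : 0 < P) (hlam : 0 < lam) (hη : 2 < η) (hr₀ : 0 < r₀)
    (x : ℕ → Ω → EuclideanSpace ℝ (Fin 2)) (h s : ℕ → Ω → ℂ) (h₀ n : Ω → ℂ)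
    (hnet : IsDownlinkNetwork μ lam r₀ N₀ x h s h₀ n) :
    -- the series defining the interference power and the interference signal converge
    (∀ᵐ ω ∂μ, Summable fun k => P * ‖h k ω‖ ^ 2 * ‖x k ω‖ ^ (-η)) ∧
    (∀ᵐ ω ∂μ, Tendsto (fun K : ℕ => ∑ k ∈ Finset.range K, interferenceTerm P η x h s k ω)
      atTop (𝓝 (aggInterference P η x h s ω))) ∧
    -- the integrals below converge
    (∀ c ∈ ({1, 2} : Finset ℕ),
      IntegrableOn (asepIntegrand M P lam η r₀ N₀ c) (Set.Ioi 0)) ∧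
    -- for square constellations the symbol error probability of the detector is the averaged one
    (∀ m : ℕ, M = m ^ 2 →
      symbolErrorProb μ (squareQAM m) P η r₀ x h s h₀ n = asep μ M P η r₀ N₀ x h h₀) ∧
    -- closed form for a general path-loss exponent
    asep μ M P η r₀ N₀ x h h₀ = ∑ c ∈ ({1, 2} : Finset ℕ), qamWeight M c *
      (1 - c / √Real.pi * ∫ z in Set.Ioi (0 : ℝ), asepIntegrand M P lam η r₀ N₀ c z) ∧
    -- closed form for path-loss exponent four
    (η = 4 → asep μ M P η r₀ N₀ x h h₀ = ∑ c ∈ ({1, 2} : Finset ℕ), qamWeight M c *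
      (1 - c / √Real.pi * ∫ z in Set.Ioi (0 : ℝ), asepIntegrandFour M P lam r₀ N₀ c z)) := by
  have hlam0 := hlam.le
  have hasep : asep μ M P η r₀ N₀ x h h₀ = ∑ c ∈ ({1, 2} : Finset ℕ), qamWeight M c *
      (1 - c / √Real.pi * ∫ z in Set.Ioi (0 : ℝ), asepIntegrand M P lam η r₀ N₀ c z) := by
    have h1 := (hnet.integral_erfc_sinr hlam0 hP hη hr₀ hM (c := 1) (Or.inl rfl)).2
    have h2 := (hnet.integral_erfc_sinr hlam0 hP hη hr₀ hM (c := 2) (Or.inr rfl)).2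
    simp only [pow_one] at h1
    rw [Finset.sum_pair (by norm_num), ← h1, ← h2, asep]
  refine ⟨hnet.ae_summable_power hη hr₀, hnet.ae_tendsto_aggInterference hP hη hr₀, ?_, ?_, hasep,
    ?_⟩
  · intro c hc
    exact (hnet.integral_erfc_sinr hlam0 hP hη hr₀ hM (by simpa using hc)).1
  · rintro m rfl
    exact hnet.symbolErrorProb_eq_asep hP hη hr₀ hM
  · rintro rfl
    rw [hasep]
    refine Finset.sum_congr rfl fun c _ => ?_
    rw [setIntegral_congr_fun measurableSet_Ioi fun z hz => asepIntegrand_four hM hz]
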